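/- **Setting.** Let $d\in\{2,3\}$ and let $D\subset\mathbb R^d$ be a bounded domain (nonempty, open, connected; for example with Lipschitz boundary). Let $H^1_0(D)$ be the closure of $C_c^\infty(D)$ in $H^1(D)$, and let $\|A\|_{W^{1,\infty}(D)}=\max\{\|A\|_{L^\infty(D)},\|\nabla A\|_{L^\infty(D)}\}$. For a coefficient $A\in L^\infty(D)$ put $a(A;w,v)=\int_D A\,\nabla w\cdot\nabla v\,dx$ for $w,v\in H^1_0(D)$. Fix constants $C_{\rm approx},C_{\rm reg},C_{\rm unif}>0$. *Coefficients.* Let $(\Omega,\Sigma,\mathbb P)$ be a probability space, let $0<A_{\min}\le 1$ and $A_{\max}\in\mathbb R$, and let $(A^\nu)_{\nu\in\mathbb N_0}$ be random fields such that each $A^\nu:\Omega\to L^\infty(D)$ is ($\mathbb P$-almost everywhere) strongly measurable. Let $\Omega_0\subseteq\Omega$ be a set of full measure (for instance $\Omega_0=\Omega$) such that for all $\omega\in\Omega_0$ and all $\nu\ge 0$: - $A^\nu(\omega)\in W^{1,\infty}(D)$ and $A_{\min}\le A^\nu(x,\omega)\le A_{\max}$ for almost every $x\in D$; - ($H^2$-regularity)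 for every $F\in L^2(D)$ the unique $w\in H^1_0(D)$ with $a(A^\nu(\omega);w,v)=\int_D Fv\,dx$ for all $v\in H^1_0(D)$ belongs to $H^2(D)$, and $\|w\|_{H^2(D)}\le \frac{C_{\rm reg}}{A_{\min}^2}\,(1+\|A^\nu(\omega)\|_{W^{1,\infty}(D)})\,\|F\|_{L^2(D)}$. *Discretization.* Let $(\mathcal X_\ell)_{\ell\in\mathbb N_0}$ be finite-dimensional subspaces of $H^1_0(D)$ with $\mathcal X_\ell\subseteq\mathcal X_k$ for $\ell\le k$, and let $(h_\ell)_{\ell\in\mathbb N_0}$ be a nonincreasing sequence of positive numbers with $h_\ell\to0$ and $h_{\ell+1}\ge C_{\rm unif}h_\ell$ for all $\ell$, such that $$\inf_{v\in\mathcal X_\ell}\|w-v\|_{H^1(D)}\le C_{\rm approx}\,h_\ell\,\|w\|_{H^2(D)}\qquad\text{for all } \ell\ge 0,\ w\in H^2(D)\cap H^1_0(D).$$ *Double difference.* Let $f,g\in L^2(D)$ and $G(v)=\int_D g\,v\,dx$. For $\omega\in\Omega_0$ let $u_\ell^\nu(\omega)\in\mathcal X_\ell$ be the Galerkin solution, $a(A^\nu(\omega);u_\ell^\nu(\omega),v)=\int_D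 fv\,dx$ for all $v\in\mathcal X_\ell$, and for $\ell,\nu\ge1$ let $$D_\ell^\nu=(u_\ell^\nu-u_{\ell-1}^\nu)-(u_\ell^{\nu-1}-u_{\ell-1}^{\nu-1}).$$ **Theorem.** There is a constant $C>0$ depending only on $D$ (and $d$), $C_{\rm approx}$, $C_{\rm reg}$ and $C_{\rm unif}$, and in particular not on $A_{\min}$, $A_{\max}$, the coefficients, the spaces $\mathcal X_\ell$, $f$, $g$, $\omega$, $\ell$ or $\nu$, such that for all $\omega\in\Omega_0$ and all $\ell,\nu\ge1$ $$|G(D_\ell^\nu(\omega))|\le \overline C_{\rm prod}(\omega)\,h_\ell^2\,\min\bigl\{1,\|(A^\nu-A^{\nu-1})(\omega)\|_{W^{1,\infty}(D)}\bigr\}\,\|f\|_{L^2(D)}\,\|g\|_{L^2(D)},$$ where $$\overline C_{\rm prod}(\omega)= C\,A_{\min}^{-5}A_{\max}\,\|A^\nu(\omega)\|_{W^{1,\infty}(D)}\,\|A^{\nu-1}(\omega)\|_{W^{1,\infty}(D)}\,C_{\rm prod}(\omega),$$ $$C_{\rm prod}(\omega)=A_{\min}^{-5}A_{\max}^{1/2}\Bigl(1+\max_{i\in\{0,1\}}\|A^{\nu-i}(\omega)\|_{W^{1,\infty}(D)}\Bigr)^2.$$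 -/

import Mathlib

open MeasureTheory Filter Topology
open scoped ENNReal

namespace MIFEM

/-- Physical space `ℝ^d` with its Euclidean norm. -/
abbrev Space (d : ℕ) : Type := EuclideanSpace ℝ (Fin d)

/-- `L²(D)`. -/
abbrev L2 {d : ℕ} (D : Set (Space d)) : Type := Lp ℝ 2 (volume.restrict D)

/-- `L²(D)^d`. -/
abbrev L2Vec {d : ℕ} (D : Set (Space d)) : Type := Lp (Space d) 2 (volume.restrict D)

/-- `L²(D)^{d × d}`, with the Frobenius norm on matrices. -/
abbrev L2Mat {d : ℕ} (D : Set (Space d)) : Type :=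
  Lp (EuclideanSpace ℝ (Fin d × Fin d)) 2 (volume.restrict D)

/-- Smooth functions with compact support in `D`. -/
def IsTestFunction {d : ℕ} (D : Set (Space d)) (φ : Space d → ℝ) : Prop :=
  ContDiff ℝ (⊤ : ℕ∞) φ ∧ HasCompactSupport φ ∧ tsupport φ ⊆ D

/-- `p` is the weak gradient of `u` in `D`. -/
def HasWeakGradient {d : ℕ} (D : Set (Space d)) (u : Space d → ℝ) (p : Space d → Space d) :
    Prop :=
  ∀ φ : Space d → ℝ, IsTestFunction D φ → ∀ i : Fin d,
    ∫ x in D, u x * fderiv ℝ φ x (EuclideanSpace.single i 1) = - ∫ x in D, p x i * φ x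

/-- Pairs `(u, p) ∈ L²(D) × L²(D)^d` with `‖(u, p)‖² = ‖u‖² + ‖p‖²`. A function `u ∈ H¹(D)` is
represented by the pair `(u, ∇u)`, so that the norm of the pair is the `H¹(D)`-norm of `u`. -/
abbrev Jet1 {d : ℕ} (D : Set (Space d)) : Type := WithLp 2 (L2 D × L2Vec D)

/-- Triples `(u, p, Q)` with `‖(u, p, Q)‖² = ‖u‖² + ‖p‖² + ‖Q‖²`. A function `u ∈ H²(D)` is
represented by the triple of `u`, its gradient and its Hessian, so that the norm of the triple is
the `H²(D)`-norm of `u`. -/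
abbrev Jet2 {d : ℕ} (D : Set (Space d)) : Type := WithLp 2 (Jet1 D × L2Mat D)

/-- `H¹₀(D)`: the closure in the `H¹(D)`-norm of the smooth functions with compact support in
`D`. -/
noncomputable def H10 {d : ℕ} (D : Set (Space d)) : Submodule ℝ (Jet1 D) :=
  (Submodule.span ℝ {w : Jet1 D | ∃ φ : Space d → ℝ, IsTestFunction D φ ∧
    (w.fst =ᵐ[volume.restrict D] φ) ∧
    (w.snd =ᵐ[volume.restrict D] fun x => gradient φ x)}).topologicalClosure

/-- The triple `U = (u, p, Q)` consists of a function `u ∈ H²(D)`, its weak gradient and its weak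
Hessian. -/
def IsH2 {d : ℕ} (D : Set (Space d)) (U : Jet2 D) : Prop :=
  HasWeakGradient D (U.fst.fst : Space d → ℝ) (U.fst.snd : Space d → Space d) ∧
  ∀ i : Fin d, HasWeakGradient D (fun x => (U.fst.snd : Space d → Space d) x i)
    (fun x => WithLp.toLp 2 fun j =>
      (U.snd : Space d → EuclideanSpace ℝ (Fin d × Fin d)) x (i, j))

/-- Pairs `(A, B) ∈ L^∞(D) × L^∞(D)^d` with the norm `max (‖A‖_∞) (‖B‖_∞)`. A function
`A ∈ W^{1,∞}(D)` is represented by the pair `(A, ∇A)`, so that the norm of the pair is the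
`W^{1,∞}(D)`-norm of `A`. -/
abbrev Jet1Inf {d : ℕ} (D : Set (Space d)) : Type :=
  Lp ℝ ∞ (volume.restrict D) × Lp (Space d) ∞ (volume.restrict D)

/-- The pair `(A, B)` consists of a function in `W^{1,∞}(D)` and its weak gradient. -/
def IsW1Inf {d : ℕ} (D : Set (Space d)) (A : Jet1Inf D) : Prop :=
  HasWeakGradient D (A.1 : Space d → ℝ) (A.2 : Space d → Space d)

/-- The bilinear form `a(A; w, v) = ∫_D A ∇w · ∇v dx` on `H¹₀(D)`. -/
noncomputable def bilin {d : ℕ} {D : Set (Space d)} (A : Lp ℝ ∞ (volume.restrict D))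
    (w v : H10 D) : ℝ :=
  ∫ x in D, A x * inner ℝ ((w : Jet1 D).snd x) ((v : Jet1 D).snd x)

/-- The functional `v ↦ ∫_D g v dx` on `H¹₀(D)` with representer `g ∈ L²(D)`. -/
noncomputable def functional {d : ℕ} {D : Set (Space d)} (g : L2 D) (v : H10 D) : ℝ :=
  ∫ x in D, g x * (v : Jet1 D).fst x

/-- `u` is a Galerkin solution in the subspace `X` of `H¹₀(D)` for the coefficient `A` and the
right-hand side `f`. -/
def IsGalerkinSolution {d : ℕ} {D : Set (Space d)} (X : Submodule ℝ (H10 D))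
    (A : Lp ℝ ∞ (volume.restrict D)) (f : L2 D) (u : H10 D) : Prop :=
  u ∈ X ∧ ∀ v ∈ X, bilin A u v = functional f v

open Classical in
/-- The solution operator: the Galerkin solution in `X`, which exists and is unique by the
Lax-Milgram lemma when `X` is closed and `A` is bounded below by a positive constant. The value
`0` is used only if there is no solution. The exact solution in `H¹₀(D)` is the case `X = ⊤`. -/
noncomputable def solution {d : ℕ} {D : Set (Space d)} (X : Submodule ℝ (H10 D))
    (A : Lp ℝ ∞ (volume.restrict D)) (f : L2 D) : H10 D :=
  if h : ∃ u, IsGalerkinSolution X A f u then h.choose else 0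

/-- The discrete spaces `X ℓ ⊆ H¹₀(D)` are finite dimensional and nested and have the
approximation property of order one with respect to the mesh widths `h ℓ`, which decrease to
zero, but not faster than geometrically. -/
structure IsFEHierarchy {d : ℕ} (D : Set (Space d)) (Capprox Cunif : ℝ)
    (X : ℕ → Submodule ℝ (H10 D)) (h : ℕ → ℝ) : Prop where
  finiteDimensional : ∀ l, FiniteDimensional ℝ (X l)
  nested : Monotone X
  mesh_pos : ∀ l, 0 < h l
  mesh_antitone : Antitone h
  mesh_tendsto : Tendsto h atTop (𝓝 0)
  mesh_ratio : ∀ l, Cunif * h l ≤ h (l + 1)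
  approx : ∀ l, ∀ w : H10 D, ∀ U : Jet2 D, IsH2 D U → U.fst = (w : Jet1 D) →
    ⨅ v : X l, ‖w - (v : H10 D)‖ ≤ Capprox * h l * ‖U‖

/-- The coefficients `A ν`, random fields over the probability space `(Ω, P)`, have the following
properties at every point of the set `Ω₀` of full measure: they lie in `W^{1,∞}(D)` and take
values in `[Amin, Amax]`, and the exact solution operator satisfies the `H²(D)`-regularity
estimate with constant `Creg`. -/
structure IsRandomCoefficient {d : ℕ} (D : Set (Space d)) (Creg Amin Amax : ℝ)
    {Ω : Type*} [MeasurableSpace Ω] (P : Measure Ω) (Ω₀ : Set Ω)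
    (A : ℕ → Ω → Jet1Inf D) : Prop where
  full : ∀ᵐ ω ∂P, ω ∈ Ω₀
  measurable : ∀ ν, AEStronglyMeasurable (fun ω => (A ν ω).1) P
  w1inf : ∀ ω ∈ Ω₀, ∀ ν, IsW1Inf D (A ν ω)
  bounds : ∀ ω ∈ Ω₀, ∀ ν, ∀ᵐ x ∂(volume.restrict D),
    Amin ≤ (A ν ω).1 x ∧ (A ν ω).1 x ≤ Amax
  regularity : ∀ ω ∈ Ω₀, ∀ ν, ∀ F : L2 D, ∃ U : Jet2 D, IsH2 D U ∧
    U.fst = (solution ⊤ (A ν ω).1 F : Jet1 D) ∧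
    ‖U‖ ≤ Creg / Amin ^ 2 * (1 + ‖A ν ω‖) * ‖F‖

/-- The double difference
`D_ℓ^ν = (u_ℓ^ν - u_{ℓ-1}^ν) - (u_ℓ^{ν-1} - u_{ℓ-1}^{ν-1})` at `ω`, for `ℓ, ν ≥ 1`, where
`u_ℓ^ν` is the Galerkin solution in `X ℓ` for the coefficient `A ν ω`. -/
noncomputable def doubleDiff {d : ℕ} {D : Set (Space d)} {Ω : Type*}
    (X : ℕ → Submodule ℝ (H10 D)) (A : ℕ → Ω → Jet1Inf D) (f : L2 D) (l ν : ℕ) (ω : Ω) :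
    H10 D :=
  (solution (X l) (A ν ω).1 f - solution (X (l - 1)) (A ν ω).1 f)
    - (solution (X l) (A (ν - 1) ω).1 f - solution (X (l - 1)) (A (ν - 1) ω).1 f)

/-- The constant `C_prod`, up to a fixed factor, in terms of the bounds of the coefficients and of
the norms `N = ‖A^ν‖`, `N' = ‖A^{ν-1}‖` in `W^{1,∞}(D)`. -/
noncomputable def prodConst (Amin Amax N N' : ℝ) : ℝ :=
  (Amin ^ 5)⁻¹ * √Amax * (1 + max N N') ^ 2

/-- The constant of the goal functional estimate, up to a fixed factor. -/
noncomputable def goalConst (Amin Amax N N' : ℝ) : ℝ :=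
  (Amin ^ 5)⁻¹ * Amax * N * N' * prodConst Amin Amax N N'

end MIFEM

open MIFEM

/-! The proof is a duality argument in the energy. Write `du`, `dz` for the level increments of the
Galerkin solutions with data `f`, `g` and coefficient `A = A^ν`, and `du'`, `dz'` for those with `A'
= A^{ν-1}`. Galerkin orthogonality of `du` to the coarse space gives `G(du) = a(A; du, dz)`
(`functional_increment`), so that `G(D_ℓ^ν) = a(A; du, dz) - a(A'; du', dz')`. By Céa's lemma and
`H²`-regularity all four increments have gradient norm `O(h_ℓ)`. Bounding the two terms separately
gives the factor `h_ℓ²` with minimum `1`. For the factor `δ = ‖A - A'‖` the difference is telescoped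
into `a(A - A'; du, dz) + a(A'; du - du', dz) + a(A'; du', dz - dz')`, which needs gradient norms
`O(δ h_ℓ)` for `du - du'` and `dz - dz'`.

That mixed bound (`norm_grad_error_sub_le`) is the core. The difference `u - u'` of the exact
solutions solves the problem for `A` with source `div((A - A')∇u')`. This source lies in `L²` with
norm `O(δ)`, because `A - A'` is in `W^{1,∞}` and `u'` in `H²` (`exists_functional_eq_bilin`, by a
product rule for weak derivatives proved by mollification). Hence the Galerkin projection of `u -
u'` has error `O(δ h_ℓ)`. It differs from `u_ℓ - u_ℓ'` only through the perturbation `a(A - A'; u' -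
u_ℓ', ·)`, which is again `O(δ h_ℓ)`.

All estimates use the gradient norm. The Poincaré constant, which depends on the domain, serves only
for existence and uniqueness of solutions and does not enter `C`. -/

namespace MIFEM

/-! ### The energy form as a bounded bilinear form, and its comparison with the gradient norm. -/

section Energy

variable {d : ℕ} {D : Set (Space d)}

/-- The gradient of a function in `H¹₀(D)`. -/
noncomputable def grad (D : Set (Space d)) : H10 D →L[ℝ] L2Vec D :=
  (WithLp.sndL 2 ℝ (L2 D) (L2Vec D)).comp (H10 D).subtypeL

/-- The embedding of `H¹₀(D)` into `L²(D)`. -/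
noncomputable def toL2 (D : Set (Space d)) : H10 D →L[ℝ] L2 D :=
  (WithLp.fstL 2 ℝ (L2 D) (L2Vec D)).comp (H10 D).subtypeL

lemma grad_apply (v : H10 D) : grad D v = (v : Jet1 D).snd := rfl

lemma toL2_apply (v : H10 D) : toL2 D v = (v : Jet1 D).fst := rfl

lemma norm_sq_eq_toL2_add_grad (v : H10 D) : ‖v‖ ^ 2 = ‖toL2 D v‖ ^ 2 + ‖grad D v‖ ^ 2 :=
  WithLp.prod_norm_sq_eq_of_L2 (v : Jet1 D)

lemma norm_grad_le (v : H10 D) : ‖grad D v‖ ≤ ‖v‖ :=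
  abs_le_of_sq_le_sq' (by rw [norm_sq_eq_toL2_add_grad]; nlinarith [sq_nonneg ‖toL2 D v‖])
    (norm_nonneg _) |>.2

lemma functional_eq_inner (g : L2 D) (v : H10 D) : functional g v = inner ℝ g (toL2 D v) := by
  rw [L2.inner_def]
  simp only [functional, toL2_apply, RCLike.inner_apply, conj_trivial]
  exact integral_congr_ae (Eventually.of_forall fun x => mul_comm _ _)

/-- Through this form, bilinearity and continuity are inherited from the Hilbert space `L²(D)^d` and
the action of `L^∞` on it, without separate integrability checks. -/
lemma bilin_eq_inner (A : Lp ℝ ∞ (volume.restrict D)) (w v : H10 D) :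
    bilin A w v = inner ℝ (A • grad D w : L2Vec D) (grad D v) := by
  rw [L2.inner_def]
  refine integral_congr_ae ?_
  filter_upwards [Lp.coeFn_lpSMul (r := 2) A (grad D w)] with x hx
  rw [hx, Pi.smul_apply', real_inner_smul_left]
  rfl

lemma abs_bilin_le (A : Lp ℝ ∞ (volume.restrict D)) (w v : H10 D) :
    |bilin A w v| ≤ ‖A‖ * ‖grad D w‖ * ‖grad D v‖ := by
  rw [bilin_eq_inner]
  refine (abs_real_inner_le_norm _ _).trans ?_
  gcongr
  exact Lp.norm_smul_le A (grad D w)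

lemma lpSMul_real_smul (c : ℝ) (A : Lp ℝ ∞ (volume.restrict D)) (p : L2Vec D) :
    (A • (c • p) : L2Vec D) = c • (A • p : L2Vec D) := by
  have := Lp.smul_comm (r := 2) c A p
  exact this.symm

lemma bilin_symm (A : Lp ℝ ∞ (volume.restrict D)) (w v : H10 D) :
    bilin A w v = bilin A v w := by
  simp only [bilin, real_inner_comm]

/-- The bilinear form `a(A; ·, ·)` as a continuous bilinear map. -/
noncomputable def bilinL (A : Lp ℝ ∞ (volume.restrict D)) : H10 D →L[ℝ] H10 D →L[ℝ] ℝ :=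
  LinearMap.mkContinuous₂
    (LinearMap.mk₂ ℝ (bilin A)
      (fun w w' v => by
        have := Lp.add_smul (r := 2) A (grad D w) (grad D w')
        rw [bilin_eq_inner, map_add, this, inner_add_left, ← bilin_eq_inner, ← bilin_eq_inner])
      (fun c w v => by
        simp only [bilin_eq_inner, map_smul, lpSMul_real_smul, real_inner_smul_left, smul_eq_mul])
      (fun w v v' => by simp only [bilin_eq_inner, map_add, inner_add_right])
      (fun c w v => by
        simp only [bilin_eq_inner, map_smul, real_inner_smul_right, smul_eq_mul]))
    ‖A‖ fun w v => by
      refine (abs_bilin_le A w v).trans ?_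
      gcongr <;> exact norm_grad_le _

lemma bilinL_apply (A : Lp ℝ ∞ (volume.restrict D)) (w v : H10 D) :
    bilinL A w v = bilin A w v := rfl

lemma bilin_sub_left (A : Lp ℝ ∞ (volume.restrict D)) (w w' v : H10 D) :
    bilin A (w - w') v = bilin A w v - bilin A w' v := by
  simp only [← bilinL_apply, map_sub, sub_apply]

lemma bilin_sub_right (A : Lp ℝ ∞ (volume.restrict D)) (w v v' : H10 D) :
    bilin A w (v - v') = bilin A w v - bilin A w v' := by
  simp only [← bilinL_apply, map_sub]

lemma bilin_sub_coeff (A A' : Lp ℝ ∞ (volume.restrict D)) (w v : H10 D) :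
    bilin (A - A') w v = bilin A w v - bilin A' w v := by
  have h := Lp.smul_add (r := 2) A (-A') (grad D w)
  have h' := Lp.neg_smul (r := 2) A' (grad D w)
  rw [bilin_eq_inner, sub_eq_add_neg A A', h, h', inner_add_left, inner_neg_left,
    ← bilin_eq_inner, ← bilin_eq_inner, sub_eq_add_neg]

lemma functional_sub (g : L2 D) (v v' : H10 D) :
    functional g (v - v') = functional g v - functional g v' := by
  simp only [functional_eq_inner, map_sub, inner_sub_right]

lemma integrable_coeff_mul_sq (A : Lp ℝ ∞ (volume.restrict D)) (p : L2Vec D) :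
    Integrable (fun x => A x * ‖p x‖ ^ 2) (volume.restrict D) := by
  refine (L2.integrable_inner (𝕜 := ℝ) (A • p : L2Vec D) p).congr ?_
  filter_upwards [Lp.coeFn_lpSMul (r := 2) A p] with x hx
  rw [hx, Pi.smul_apply', real_inner_smul_left, real_inner_self_eq_norm_sq]

lemma integral_norm_sq (p : L2Vec D) : ∫ x in D, ‖p x‖ ^ 2 = ‖p‖ ^ 2 := by
  rw [← real_inner_self_eq_norm_sq, L2.inner_def]
  simp only [real_inner_self_eq_norm_sq]

lemma integrable_norm_sq (p : L2Vec D) :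
    Integrable (fun x => ‖p x‖ ^ 2) (volume.restrict D) := by
  simpa only [real_inner_self_eq_norm_sq] using L2.integrable_inner (𝕜 := ℝ) p p

lemma bilin_self (A : Lp ℝ ∞ (volume.restrict D)) (v : H10 D) :
    bilin A v v = ∫ x in D, A x * ‖grad D v x‖ ^ 2 := by
  simp only [bilin, real_inner_self_eq_norm_sq, grad_apply]

lemma le_bilin_self {A : Lp ℝ ∞ (volume.restrict D)} {a : ℝ}
    (hA : ∀ᵐ x ∂(volume.restrict D), a ≤ A x) (v : H10 D) :
    a * ‖grad D v‖ ^ 2 ≤ bilin A v v := by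
  rw [bilin_self, ← integral_norm_sq, ← integral_const_mul]
  refine integral_mono_ae ((integrable_norm_sq _).const_mul _) (integrable_coeff_mul_sq _ _) ?_
  filter_upwards [hA] with x hx
  gcongr

lemma bilin_self_le {A : Lp ℝ ∞ (volume.restrict D)} {b : ℝ}
    (hA : ∀ᵐ x ∂(volume.restrict D), A x ≤ b) (v : H10 D) :
    bilin A v v ≤ b * ‖grad D v‖ ^ 2 := by
  rw [bilin_self, ← integral_norm_sq, ← integral_const_mul]
  refine integral_mono_ae (integrable_coeff_mul_sq _ _) ((integrable_norm_sq _).const_mul _) ?_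
  filter_upwards [hA] with x hx
  gcongr

end Energy

/-! ### Density of test functions and the Poincaré inequality. -/

section Poincare

variable {d : ℕ} {D : Set (Space d)}

/-- The test functions, together with their gradients, as elements of `H¹(D)`. -/
def testSet (D : Set (Space d)) : Set (Jet1 D) :=
  {w : Jet1 D | ∃ φ : Space d → ℝ, IsTestFunction D φ ∧
    (w.fst =ᵐ[volume.restrict D] φ) ∧
    (w.snd =ᵐ[volume.restrict D] fun x => gradient φ x)}

lemma IsTestFunction.differentiable {φ : Space d → ℝ} (h : IsTestFunction D φ) :
    Differentiable ℝ φ := h.1.differentiable (by simp)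

lemma IsTestFunction.continuous {φ : Space d → ℝ} (h : IsTestFunction D φ) :
    Continuous φ := h.1.continuous

lemma IsTestFunction.continuous_fderiv_apply {φ : Space d → ℝ} (h : IsTestFunction D φ)
    (v : Space d) : Continuous fun x => fderiv ℝ φ x v :=
  (h.1.continuous_fderiv (by simp)).clm_apply continuous_const

lemma IsTestFunction.hasCompactSupport_fderiv_apply {φ : Space d → ℝ} (h : IsTestFunction D φ)
    (v : Space d) : HasCompactSupport fun x => fderiv ℝ φ x v :=
  h.2.1.fderiv_apply ℝ v

lemma gradient_apply_eq_fderiv (φ : Space d → ℝ) (x : Space d) (i : Fin d) :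
    gradient φ x i = fderiv ℝ φ x (EuclideanSpace.single i 1) := by
  have h : inner ℝ (gradient φ x) (EuclideanSpace.single i (1 : ℝ))
      = fderiv ℝ φ x (EuclideanSpace.single i 1) := by
    simp [gradient, InnerProductSpace.toDual_symm_apply]
  rw [← h, EuclideanSpace.inner_single_right]
  simp

lemma IsTestFunction.gradient_eq_zero {φ : Space d → ℝ} (h : IsTestFunction D φ) {x : Space d}
    (hx : x ∉ D) : φ x = 0 ∧ gradient φ x = 0 := by
  have hx' : x ∉ tsupport φ := fun h' => hx (h.2.2 h')
  refine ⟨image_eq_zero_of_notMem_tsupport hx', ?_⟩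
  rw [gradient, image_eq_zero_of_notMem_tsupport (fun h' => hx' (tsupport_fderiv_subset ℝ h')),
    map_zero]

lemma integrable_coord_mul {φ : Space d → ℝ} (h : IsTestFunction D φ) (i : Fin d) :
    Integrable fun x : Space d => (2 * x i) * (φ x * gradient φ x i) := by
  have hcg : Continuous fun x => gradient φ x i := by
    simpa only [gradient_apply_eq_fderiv] using
      h.continuous_fderiv_apply (EuclideanSpace.single i 1)
  have hs : HasCompactSupport fun x => φ x * gradient φ x i := h.2.1.mul_right
  have hci : Continuous fun y : Space d => y i := by fun_prop
  exact ((continuous_const.mul hci).mul (h.continuous.mul hcg)).integrable_of_hasCompactSupport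
    (hs.mul_left (f := fun x : Space d => 2 * x i))

/-- Write `φ² = (∂_i x_i) φ²` and integrate by parts. On a bounded domain the weight `x_i` is
bounded, which is the source of the Poincaré inequality. -/
lemma integral_coord_mul {φ : Space d → ℝ} (h : IsTestFunction D φ) (i : Fin d) :
    ∫ x, φ x ^ 2 = - ∫ x, (2 * x i) * (φ x * gradient φ x i) := by
  have hφ := h.differentiable
  have hc := h.continuous
  have hcs := h.2.1
  have hd := h.continuous_fderiv_apply (EuclideanSpace.single i 1)
  have hcoord : ∀ x : Space d, fderiv ℝ (fun y : Space d => y i) x (EuclideanSpace.single i 1) = 1 := by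
    intro x
    have : HasFDerivAt (fun y : Space d => y i) (EuclideanSpace.proj i : Space d →L[ℝ] ℝ) x :=
      (EuclideanSpace.proj i : Space d →L[ℝ] ℝ).hasFDerivAt
    rw [this.fderiv]
    simp
  have hci : Continuous fun y : Space d => y i := by fun_prop
  have hdi : Differentiable ℝ fun y : Space d => y i :=
    fun x => (EuclideanSpace.proj i : Space d →L[ℝ] ℝ).differentiableAt
  have hsq : ∀ x, fderiv ℝ (fun y => φ y ^ 2) x (EuclideanSpace.single i 1)
      = 2 * (φ x * gradient φ x i) := by
    intro x
    rw [gradient_apply_eq_fderiv, ((hφ x).hasFDerivAt.pow 2).fderiv]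
    simp
    ring
  have hcg : Continuous fun x => gradient φ x i := by
    simpa only [gradient_apply_eq_fderiv] using hd
  have key := integral_mul_fderiv_eq_neg_fderiv_mul_of_integrable (μ := (volume : Measure (Space d)))
    (f := fun y => y i) (g := fun y => φ y ^ 2) (v := EuclideanSpace.single i (1 : ℝ)) ?_ ?_ ?_
    (fun x _ => hdi x) (fun x _ => (hφ x).pow 2)
  · simp only [hcoord, hsq, one_mul] at key
    rw [← neg_eq_iff_eq_neg.mpr key]
    congr 1
    exact integral_congr_ae (Eventually.of_forall fun x => by ring)
  · simp only [hcoord, one_mul, pow_two]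
    have hs : HasCompactSupport fun x => φ x * φ x := hcs.mul_right
    exact (hc.mul hc).integrable_of_hasCompactSupport hs
  · simp only [hsq]
    have hs : HasCompactSupport fun x => φ x * gradient φ x i := hcs.mul_right
    have hs' : HasCompactSupport fun x => 2 * (φ x * gradient φ x i) :=
      hs.mul_left (f := fun _ => (2 : ℝ))
    exact (hci.mul (continuous_const.mul (hc.mul hcg))).integrable_of_hasCompactSupport
      (hs'.mul_left (f := fun x : Space d => x i))
  · simp only [pow_two]
    have hs : HasCompactSupport fun x => φ x * φ x := hcs.mul_right
    exact (hci.mul (hc.mul hc)).integrable_of_hasCompactSupport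
      (hs.mul_left (f := fun x : Space d => x i))

lemma gradient_add_smul {φ ψ : Space d → ℝ} (hφ : Differentiable ℝ φ) (hψ : Differentiable ℝ ψ)
    (c : ℝ) (x : Space d) :
    gradient (fun y => φ y + c * ψ y) x = gradient φ x + c • gradient ψ x := by
  have h := (hφ x).hasFDerivAt.add ((hψ x).hasFDerivAt.const_mul c)
  have h' : fderiv ℝ (fun y => φ y + c * ψ y) x = fderiv ℝ φ x + c • fderiv ℝ ψ x := h.fderiv
  rw [gradient, gradient, gradient, h', map_add, map_smul]

lemma IsTestFunction.add_smul {φ ψ : Space d → ℝ} (hφ : IsTestFunction D φ)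
    (hψ : IsTestFunction D ψ) (c : ℝ) : IsTestFunction D fun y => φ y + c * ψ y := by
  have hs : HasCompactSupport fun y => c * ψ y := hψ.2.1.mul_left (f := fun _ => c)
  refine ⟨hφ.1.add (contDiff_const.mul hψ.1), hφ.2.1.add hs, ?_⟩
  refine (tsupport_add φ fun y => c * ψ y).trans (Set.union_subset hφ.2.2 ?_)
  exact (tsupport_mul_subset_right (f := fun _ => c) (g := ψ)).trans hψ.2.2

lemma add_smul_mem_testSet {v w : Jet1 D} (hv : v ∈ testSet D) (hw : w ∈ testSet D) (c : ℝ) :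
    v + c • w ∈ testSet D := by
  obtain ⟨φ, hφ, hv1, hv2⟩ := hv
  obtain ⟨ψ, hψ, hw1, hw2⟩ := hw
  refine ⟨_, hφ.add_smul hψ c, ?_, ?_⟩
  · filter_upwards [Lp.coeFn_add v.fst (c • w.fst), Lp.coeFn_smul c w.fst, hv1, hw1]
      with x h1 h2 h3 h4
    rw [WithLp.add_fst, WithLp.smul_fst, h1, Pi.add_apply, h2, Pi.smul_apply, h3, h4, smul_eq_mul]
  · filter_upwards [Lp.coeFn_add v.snd (c • w.snd), Lp.coeFn_smul c w.snd, hv2, hw2]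
      with x h1 h2 h3 h4
    rw [WithLp.add_snd, WithLp.smul_snd, h1, Pi.add_apply, h2, Pi.smul_apply, h3, h4,
      gradient_add_smul hφ.differentiable hψ.differentiable]

lemma zero_mem_testSet : (0 : Jet1 D) ∈ testSet D := by
  refine ⟨fun _ => 0, ⟨contDiff_const, HasCompactSupport.zero, by simp [tsupport]⟩, ?_, ?_⟩
  · exact Lp.coeFn_zero ℝ 2 (volume.restrict D)
  · filter_upwards [Lp.coeFn_zero (Space d) 2 (volume.restrict D)] with x hx
    rw [WithLp.zero_snd, hx, gradient_fun_const]
    rfl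

/-- The test functions already form a linear space, so the span in the definition of `H10` adds
nothing and only the closure has to be handled. The property `p` need therefore not be linear, and
norm inequalities are allowed. -/
lemma H10_induction {p : Jet1 D → Prop} (hp : IsClosed {w | p w})
    (htest : ∀ w ∈ testSet D, p w) (w : H10 D) : p w := by
  have hw : (w : Jet1 D) ∈ closure ((Submodule.span ℝ (testSet D) : Submodule ℝ (Jet1 D)) :
      Set (Jet1 D)) := w.2
  refine closure_minimal (fun v hv => htest v ?_) hp hw
  refine Submodule.span_induction (p := fun v _ => v ∈ testSet D) (fun _ h => h) zero_mem_testSet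
    (fun v w _ _ hv hw => ?_) (fun c v _ hv => ?_) hv
  · simpa using add_smul_mem_testSet hv hw 1
  · simpa using add_smul_mem_testSet zero_mem_testSet hv c

/-- The **Poincaré inequality** on `H¹₀(D)` for bounded `D`. -/
theorem exists_norm_toL2_le (hd : 0 < d) (hDm : MeasurableSet D) (hDb : Bornology.IsBounded D) :
    ∃ K : ℝ, 0 ≤ K ∧ ∀ v : H10 D, ‖toL2 D v‖ ≤ K * ‖grad D v‖ := by
  obtain ⟨R, hR⟩ := hDb.exists_norm_le
  have hR0 : 0 ≤ max R 0 := le_max_right _ _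
  refine ⟨2 * max R 0, by positivity, H10_induction (p := fun w => ‖w.fst‖ ≤ 2 * max R 0 * ‖w.snd‖) ?_ ?_⟩
  · exact isClosed_le (WithLp.fstL 2 ℝ (L2 D) (L2Vec D)).continuous.norm
      (continuous_const.mul (WithLp.sndL 2 ℝ (L2 D) (L2Vec D)).continuous.norm)
  rintro w ⟨φ, hφ, h1, h2⟩
  have hsq : ‖w.fst‖ ^ 2 = ∫ x in D, φ x ^ 2 := by
    rw [← real_inner_self_eq_norm_sq, L2.inner_def]
    refine integral_congr_ae ?_
    filter_upwards [h1] with x hx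
    rw [hx, real_inner_self_eq_norm_sq, Real.norm_eq_abs, sq_abs]
  have hsq' : ‖w.snd‖ ^ 2 = ∫ x in D, ‖gradient φ x‖ ^ 2 := by
    rw [← integral_norm_sq]
    refine integral_congr_ae ?_
    filter_upwards [h2] with x hx
    rw [hx]
  have i1 : Integrable (fun x => φ x ^ 2) (volume.restrict D) := by
    refine (L2.integrable_inner (𝕜 := ℝ) w.fst w.fst).congr ?_
    filter_upwards [h1] with x hx
    rw [hx, real_inner_self_eq_norm_sq, Real.norm_eq_abs, sq_abs]
  have i2 : Integrable (fun x => ‖gradient φ x‖ ^ 2) (volume.restrict D) := by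
    refine (integrable_norm_sq w.snd).congr ?_
    filter_upwards [h2] with x hx
    rw [hx]
  have hpt : ∀ x ∈ D, -((2 * x ⟨0, hd⟩) * (φ x * gradient φ x ⟨0, hd⟩))
      ≤ 1 / 2 * φ x ^ 2 + 2 * (max R 0) ^ 2 * ‖gradient φ x‖ ^ 2 := by
    intro x hx
    have hx1 : |x ⟨0, hd⟩| ≤ max R 0 :=
      ((PiLp.norm_apply_le x ⟨0, hd⟩).trans (hR x hx)).trans (le_max_left _ _)
    have hx2 : |gradient φ x ⟨0, hd⟩| ≤ ‖gradient φ x‖ :=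
      PiLp.norm_apply_le (gradient φ x) ⟨0, hd⟩
    have hm : |x ⟨0, hd⟩ * gradient φ x ⟨0, hd⟩| ≤ max R 0 * ‖gradient φ x‖ := by
      rw [abs_mul]
      gcongr
    have := sq_le_sq' (abs_le.mp hm).1 (abs_le.mp hm).2
    -- Young's inequality, weighted so that half of `∫ φ²` can be absorbed on the left; this yields
    -- the constant `2R`.
    nlinarith [sq_nonneg (φ x + 2 * (x ⟨0, hd⟩ * gradient φ x ⟨0, hd⟩))]
  have hmain : ∫ x in D, φ x ^ 2
      ≤ 1 / 2 * (∫ x in D, φ x ^ 2) + 2 * (max R 0) ^ 2 * ∫ x in D, ‖gradient φ x‖ ^ 2 := by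
    have e1 : ∫ x in D, φ x ^ 2 = ∫ x, φ x ^ 2 :=
      setIntegral_eq_integral_of_forall_compl_eq_zero fun x hx => by
        rw [(hφ.gradient_eq_zero hx).1, zero_pow two_ne_zero]
    have e2 : ∫ x in D, (2 * x ⟨0, hd⟩) * (φ x * gradient φ x ⟨0, hd⟩)
        = ∫ x, (2 * x ⟨0, hd⟩) * (φ x * gradient φ x ⟨0, hd⟩) :=
      setIntegral_eq_integral_of_forall_compl_eq_zero fun x hx => by
        rw [(hφ.gradient_eq_zero hx).1, zero_mul, mul_zero]
    have e3 := integral_coord_mul hφ ⟨0, hd⟩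
    rw [← e1, ← e2, ← integral_neg] at e3
    rw [← integral_const_mul, ← integral_const_mul, ← integral_add (i1.const_mul _)
      (i2.const_mul _)]
    refine e3.le.trans ?_
    have hi : Integrable (fun x => (2 * x ⟨0, hd⟩) * (φ x * gradient φ x ⟨0, hd⟩))
        (volume.restrict D) := (integrable_coord_mul hφ ⟨0, hd⟩).restrict
    refine integral_mono_ae hi.neg ((i1.const_mul _).add (i2.const_mul _)) ?_
    exact (ae_restrict_iff' hDm).mpr (Eventually.of_forall hpt)
  rw [← hsq, ← hsq'] at hmain
  refine abs_le_of_sq_le_sq' ?_ (by positivity) |>.2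
  nlinarith

end Poincare

/-! ### Existence and uniqueness of Galerkin solutions. -/

section LaxMilgram

/-- The **Lax–Milgram lemma** in a complete subspace. -/
theorem exists_mem_forall_eq_of_coercive {H : Type*} [NormedAddCommGroup H]
    [InnerProductSpace ℝ H] {B : H →L[ℝ] H →L[ℝ] ℝ} {c : ℝ} (hc : 0 < c)
    (hB : ∀ u, c * ‖u‖ * ‖u‖ ≤ B u u) (L : H →L[ℝ] ℝ) (X : Submodule ℝ H) [CompleteSpace X] :
    ∃ u ∈ X, ∀ v ∈ X, B u v = L v := by
  let B' : X →L[ℝ] X →L[ℝ] ℝ := B.bilinearComp X.subtypeL X.subtypeL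
  have hB' : IsCoercive B' := ⟨c, hc, fun u => hB u⟩
  let r : X := (InnerProductSpace.toDual ℝ X).symm (L.comp X.subtypeL)
  refine ⟨(hB'.continuousLinearEquivOfBilin.symm r : X), Submodule.coe_mem _, fun v hv => ?_⟩
  have h := hB'.continuousLinearEquivOfBilin_apply (hB'.continuousLinearEquivOfBilin.symm r)
    ⟨v, hv⟩
  rw [ContinuousLinearEquiv.apply_symm_apply, InnerProductSpace.toDual_symm_apply] at h
  exact h.symm

variable {d : ℕ} {D : Set (Space d)}

instance : CompleteSpace (H10 D) :=
  (Submodule.isClosed_topologicalClosure _).completeSpace_coe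

lemma norm_sq_le_of_poincare {K : ℝ} (hK : ∀ v : H10 D, ‖toL2 D v‖ ≤ K * ‖grad D v‖)
    (v : H10 D) : ‖v‖ ^ 2 ≤ (K ^ 2 + 1) * ‖grad D v‖ ^ 2 := by
  have := pow_le_pow_left₀ (norm_nonneg _) (hK v) 2
  rw [norm_sq_eq_toL2_add_grad]
  nlinarith

/-- Existence of Galerkin solutions. -/
theorem exists_isGalerkinSolution {K : ℝ} (hK : ∀ v : H10 D, ‖toL2 D v‖ ≤ K * ‖grad D v‖)
    {A : Lp ℝ ∞ (volume.restrict D)} {a : ℝ} (ha : 0 < a)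
    (hA : ∀ᵐ x ∂(volume.restrict D), a ≤ A x) (X : Submodule ℝ (H10 D)) [CompleteSpace X]
    (f : L2 D) : ∃ u, IsGalerkinSolution X A f u := by
  -- Coercivity in the full `H¹`-norm: the Poincaré inequality costs the factor `K² + 1`.
  have hB : ∀ u : H10 D, a / (K ^ 2 + 1) * ‖u‖ * ‖u‖ ≤ bilinL A u u := fun u => by
    have h1 := norm_sq_le_of_poincare hK u
    have h2 : a * ‖grad D u‖ ^ 2 ≤ bilinL A u u := le_bilin_self hA u
    rw [mul_assoc, ← pow_two, div_mul_eq_mul_div, div_le_iff₀ (by positivity)]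
    have h3 : a * ‖u‖ ^ 2 ≤ a * ((K ^ 2 + 1) * ‖grad D u‖ ^ 2) := by gcongr
    nlinarith [mul_le_mul_of_nonneg_left h2 (show 0 ≤ K ^ 2 + 1 by positivity)]
  obtain ⟨u, hu, h⟩ := exists_mem_forall_eq_of_coercive (by positivity) hB
    ((innerSL ℝ f).comp (toL2 D)) X
  refine ⟨u, hu, fun v hv => ?_⟩
  rw [functional_eq_inner]
  exact h v hv

theorem isGalerkinSolution_solution {K : ℝ} (hK : ∀ v : H10 D, ‖toL2 D v‖ ≤ K * ‖grad D v‖)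
    {A : Lp ℝ ∞ (volume.restrict D)} {a : ℝ} (ha : 0 < a)
    (hA : ∀ᵐ x ∂(volume.restrict D), a ≤ A x) (X : Submodule ℝ (H10 D)) [CompleteSpace X]
    (f : L2 D) : IsGalerkinSolution X A f (solution X A f) := by
  have h := exists_isGalerkinSolution hK ha hA X f
  rw [solution, dif_pos h]
  exact h.choose_spec

theorem IsGalerkinSolution.unique {K : ℝ} (hK : ∀ v : H10 D, ‖toL2 D v‖ ≤ K * ‖grad D v‖)
    {A : Lp ℝ ∞ (volume.restrict D)} {a : ℝ} (ha : 0 < a)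
    (hA : ∀ᵐ x ∂(volume.restrict D), a ≤ A x) {X : Submodule ℝ (H10 D)} {f : L2 D}
    {u u' : H10 D} (hu : IsGalerkinSolution X A f u) (hu' : IsGalerkinSolution X A f u') :
    u = u' := by
  have hX : u - u' ∈ X := X.sub_mem hu.1 hu'.1
  have h0 : bilin A (u - u') (u - u') = 0 := by
    rw [bilin_sub_left, hu.2 _ hX, hu'.2 _ hX, sub_self]
  have h1 := le_bilin_self hA (u - u')
  have h2 := norm_sq_le_of_poincare hK (u - u')
  have h3 : ‖grad D (u - u')‖ ^ 2 = 0 :=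
    le_antisymm (by rw [h0] at h1; exact nonpos_of_mul_nonpos_right h1 ha) (by positivity)
  rw [h3, mul_zero] at h2
  have h4 : ‖u - u'‖ = 0 := pow_eq_zero_iff two_ne_zero |>.mp (le_antisymm h2 (by positivity))
  exact sub_eq_zero.mp (norm_eq_zero.mp h4)

end LaxMilgram

/-! ### Mollification and the product rule for weak derivatives. -/

section Mollification

open ContinuousLinearMap

variable {d : ℕ} {D : Set (Space d)}

/-- Bump functions on `ℝ^d` whose supports shrink to the origin. -/
noncomputable def bump (d n : ℕ) : ContDiffBump (0 : Space d) where
  rIn := 1 / (n + 1 : ℝ)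
  rOut := 2 / (n + 1 : ℝ)
  rIn_pos := by positivity
  rIn_lt_rOut := by gcongr; norm_num

/-- The nonnegative smooth kernels of the mollification. -/
noncomputable def kernel (d n : ℕ) : Space d → ℝ := (bump d n).normed volume

/-- The mollification of the extension by zero of a function on `D`. -/
noncomputable def mollify (D : Set (Space d)) (n : ℕ) (g : Space d → ℝ) : Space d → ℝ :=
  convolution (kernel d n) (D.indicator g) (lsmul ℝ ℝ) volume

lemma tendsto_bump_rOut (d : ℕ) : Tendsto (fun n => (bump d n).rOut) atTop (𝓝 0) := by
  have := (tendsto_one_div_add_atTop_nhds_zero_nat (𝕜 := ℝ)).const_mul 2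
  rw [mul_zero] at this
  refine this.congr fun n => ?_
  simp only [bump]
  ring

lemma contDiff_kernel (d n : ℕ) : ContDiff ℝ (⊤ : ℕ∞) (kernel d n) :=
  (bump d n).contDiff_normed

lemma hasCompactSupport_kernel (d n : ℕ) : HasCompactSupport (kernel d n) :=
  (bump d n).hasCompactSupport_normed

lemma locallyIntegrable_indicator (hD : MeasurableSet D) {g : Space d → ℝ}
    (hg : IntegrableOn g D) : LocallyIntegrable (D.indicator g) :=
  ((integrable_indicator_iff hD).mpr hg).locallyIntegrable

lemma mollify_apply (hD : MeasurableSet D) (n : ℕ) (g : Space d → ℝ) (x : Space d) :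
    mollify D n g x = ∫ t in D, kernel d n (x - t) * g t := by
  rw [mollify, convolution_lsmul_swap, ← integral_indicator hD]
  refine integral_congr_ae (Eventually.of_forall fun t => ?_)
  by_cases ht : t ∈ D <;> simp [ht]

lemma contDiff_mollify (hD : MeasurableSet D) {g : Space d → ℝ} (hg : IntegrableOn g D)
    (n : ℕ) : ContDiff ℝ (⊤ : ℕ∞) (mollify D n g) :=
  (hasCompactSupport_kernel d n).contDiff_convolution_left _ (contDiff_kernel d n)
    (locallyIntegrable_indicator hD hg)

lemma ae_tendsto_mollify (hD : MeasurableSet D) {g : Space d → ℝ} (hg : IntegrableOn g D) :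
    ∀ᵐ x ∂(volume.restrict D), Tendsto (fun n => mollify D n g x) atTop (𝓝 (g x)) := by
  -- The ratio of outer to inner radius stays equal to `2`, so the kernels shrink regularly and
  -- convergence holds at almost every point.
  have h := ContDiffBump.ae_convolution_tendsto_right_of_locallyIntegrable
    (μ := (volume : Measure (Space d))) (φ := bump d) (l := atTop) (K := 2)
    (tendsto_bump_rOut d)
    (Eventually.of_forall fun n => by simp only [bump]; apply le_of_eq; ring)
    (locallyIntegrable_indicator hD hg)
  rw [ae_restrict_iff' hD]
  filter_upwards [h] with x hx hxD
  rw [Set.indicator_of_mem hxD] at hx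
  exact hx

/-- The kernel is nonnegative with integral one. Uniformity in `n` and `x` is what dominated
convergence in the product rule needs. -/
lemma abs_mollify_le (hD : MeasurableSet D) {g : Space d → ℝ} {c : ℝ} (hc : 0 ≤ c)
    (hg : ∀ᵐ x ∂(volume.restrict D), |g x| ≤ c) (n : ℕ) (x : Space d) :
    |mollify D n g x| ≤ c := by
  have hk : Integrable fun t => kernel d n (x - t) :=
    ((contDiff_kernel d n).continuous.integrable_of_hasCompactSupport
      (hasCompactSupport_kernel d n)).comp_sub_left x
  have h0 : ∀ t, 0 ≤ kernel d n t := (bump d n).nonneg_normed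
  rw [mollify_apply hD, ← Real.norm_eq_abs]
  calc ‖∫ t in D, kernel d n (x - t) * g t‖
      ≤ ∫ t in D, kernel d n (x - t) * c := by
        refine norm_integral_le_of_norm_le (hk.restrict.mul_const c) ?_
        filter_upwards [hg] with t ht
        rw [norm_mul, Real.norm_of_nonneg (h0 _)]
        exact mul_le_mul_of_nonneg_left ht (h0 _)
    _ ≤ ∫ t, kernel d n (x - t) * c :=
        setIntegral_le_integral (hk.mul_const c)
          (Eventually.of_forall fun t => mul_nonneg (h0 _) hc)
    _ = c := by
        rw [integral_mul_const, integral_sub_left_eq_self (kernel d n) volume x]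
        exact (congrArg (· * c) (bump d n).integral_normed).trans (one_mul c)

lemma fderiv_mollify_apply (hD : MeasurableSet D) {g : Space d → ℝ} (hg : IntegrableOn g D)
    (n : ℕ) (x v : Space d) :
    fderiv ℝ (mollify D n g) x v = ∫ t in D, fderiv ℝ (kernel d n) (x - t) v * g t := by
  have hl := locallyIntegrable_indicator hD hg
  have hs := hasCompactSupport_kernel d n
  have hk : ContDiff ℝ 1 (kernel d n) := (contDiff_kernel d n).of_le (by simp)
  have h := hs.hasFDerivAt_convolution_left (lsmul ℝ ℝ) hk hl x
  have h' : fderiv ℝ (mollify D n g) x = _ := h.fderiv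
  have hex := (hs.fderiv ℝ).convolutionExists_left (precompL (Space d) (lsmul ℝ ℝ))
    (hk.continuous_fderiv (by simp)) hl x
  rw [h', convolution_eq_swap, ContinuousLinearMap.integral_apply hex.integrable_swap,
    ← integral_indicator hD]
  refine integral_congr_ae (Eventually.of_forall fun t => ?_)
  by_cases ht : t ∈ D <;> simp [ht, precompL_apply]

lemma IsTestFunction.of_kernel {n : ℕ} {x : Space d}
    (hx : Metric.closedBall x (bump d n).rOut ⊆ D) :
    IsTestFunction D fun t => kernel d n (x - t) := by
  have hsub : (tsupport fun t => kernel d n (x - t)) ⊆ Metric.closedBall x (bump d n).rOut := by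
    refine closure_minimal (fun t ht => ?_) Metric.isClosed_closedBall
    have : x - t ∈ Function.support ((bump d n).normed volume) := ht
    rw [ContDiffBump.support_normed_eq, mem_ball_zero_iff] at this
    rw [Metric.mem_closedBall, dist_comm, dist_eq_norm]
    exact this.le
  exact ⟨(contDiff_kernel d n).comp (contDiff_const.sub contDiff_id),
    (isCompact_closedBall _ _).of_isClosed_subset (isClosed_tsupport _) hsub, hsub.trans hx⟩

/-- The translated kernel is itself a test function once its support fits into `D`, so the
definition of the weak gradient applies to it. Nearer to the boundary the extension by zero may
create a jump, whence the hypothesis on the ball. -/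
lemma HasWeakGradient.fderiv_mollify {b : Space d → ℝ} {b' : Space d → Space d}
    (hD : MeasurableSet D) (h : HasWeakGradient D b b') (hb : IntegrableOn b D) {n : ℕ}
    {x : Space d} (hx : Metric.closedBall x (bump d n).rOut ⊆ D) (i : Fin d) :
    fderiv ℝ (mollify D n b) x (EuclideanSpace.single i 1) = mollify D n (fun y => b' y i) x := by
  have hk : Differentiable ℝ (kernel d n) := (contDiff_kernel d n).differentiable (by simp)
  have hd : ∀ t, fderiv ℝ (fun t => kernel d n (x - t)) t (EuclideanSpace.single i 1)
      = - fderiv ℝ (kernel d n) (x - t) (EuclideanSpace.single i 1) := by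
    intro t
    have h1 : HasFDerivAt (fun t : Space d => x - t) (-ContinuousLinearMap.id ℝ (Space d)) t :=
      (hasFDerivAt_id t).const_sub x
    have h2 := (hk (x - t)).hasFDerivAt.comp t h1
    have h3 : fderiv ℝ (fun t => kernel d n (x - t)) t = _ := h2.fderiv
    rw [h3]
    simp
  have hw := h _ (IsTestFunction.of_kernel hx) i
  -- The sign from reflecting the kernel cancels the sign in the definition of the weak gradient.
  simp only [hd, mul_neg] at hw
  rw [integral_neg, neg_inj] at hw
  rw [fderiv_mollify_apply hD hb, mollify_apply hD]
  simpa only [mul_comm] using hw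

/-- Needed when the product rule is summed over the directions `i` under the integral. -/
lemma integrable_product {b p : Space d → ℝ} {b' p' : Space d → Space d} {c : ℝ}
    (hc : 0 ≤ c) (hbi : IntegrableOn b D) (hbi' : ∀ i, IntegrableOn (fun x => b' x i) D)
    (hbc : ∀ᵐ x ∂(volume.restrict D), |b x| ≤ c)
    (hbc' : ∀ i, ∀ᵐ x ∂(volume.restrict D), |b' x i| ≤ c)
    (hpi : IntegrableOn p D) (hpi' : ∀ i, IntegrableOn (fun x => p' x i) D)
    {φ : Space d → ℝ} (hφ : IsTestFunction D φ) (i : Fin d) :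
    IntegrableOn (fun x => p x * (b x * fderiv ℝ φ x (EuclideanSpace.single i 1) + b' x i * φ x)
      + p' x i * (b x * φ x)) D := by
  obtain ⟨M₀, hM₀⟩ := hφ.continuous.bounded_above_of_compact_support hφ.2.1
  obtain ⟨M₁, hM₁⟩ := (hφ.continuous_fderiv_apply (EuclideanSpace.single i 1))
    |>.bounded_above_of_compact_support (hφ.hasCompactSupport_fderiv_apply _)
  have hcd := (hφ.continuous_fderiv_apply (EuclideanSpace.single i 1)).aestronglyMeasurable
    (μ := volume.restrict D)
  have hcφ := hφ.continuous.aestronglyMeasurable (μ := volume.restrict D)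
  refine Integrable.add ?_ ?_
  · refine Integrable.mul_bdd (c := c * M₁ + c * M₀) hpi ((hbi.aestronglyMeasurable.mul hcd).add
      ((hbi' i).aestronglyMeasurable.mul hcφ)) ?_
    filter_upwards [hbc, hbc' i] with x h1 h2
    refine (norm_add_le _ _).trans (add_le_add ?_ ?_)
    · exact (norm_mul _ _).le.trans (mul_le_mul h1 (hM₁ x) (norm_nonneg _) hc)
    · exact (norm_mul _ _).le.trans (mul_le_mul h2 (hM₀ x) (norm_nonneg _) hc)
  · refine Integrable.mul_bdd (c := c * M₀) (hpi' i) (hbi.aestronglyMeasurable.mul hcφ) ?_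
    filter_upwards [hbc] with x h1
    exact (norm_mul _ _).le.trans (mul_le_mul h1 (hM₀ x) (norm_nonneg _) hc)

/-- The product rule for a bounded function with bounded weak gradient and an integrable function
with integrable weak gradient. -/
theorem HasWeakGradient.integral_product {b p : Space d → ℝ} {b' p' : Space d → Space d}
    (hD : IsOpen D) (hb : HasWeakGradient D b b') (hp : HasWeakGradient D p p') {c : ℝ}
    (hc : 0 ≤ c) (hbi : IntegrableOn b D) (hbi' : ∀ i, IntegrableOn (fun x => b' x i) D)
    (hbc : ∀ᵐ x ∂(volume.restrict D), |b x| ≤ c)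
    (hbc' : ∀ i, ∀ᵐ x ∂(volume.restrict D), |b' x i| ≤ c)
    (hpi : IntegrableOn p D) (hpi' : ∀ i, IntegrableOn (fun x => p' x i) D)
    {φ : Space d → ℝ} (hφ : IsTestFunction D φ) (i : Fin d) :
    ∫ x in D, (p x * (b x * fderiv ℝ φ x (EuclideanSpace.single i 1) + b' x i * φ x)
      + p' x i * (b x * φ x)) = 0 := by
  have hDm := hD.measurableSet
  obtain ⟨δ, hδ, hδD⟩ := hφ.2.1.isCompact.exists_cthickening_subset_open hD hφ.2.2
  -- The compact support of `φ` keeps a positive distance from the complement of `D`, so for large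
  -- `n` mollification and differentiation commute at every point that matters.
  have hball : ∀ᶠ n in atTop, ∀ x ∈ tsupport φ, Metric.closedBall x (bump d n).rOut ⊆ D := by
    filter_upwards [(tendsto_bump_rOut d).eventually (gt_mem_nhds hδ)] with n hn x hx
    exact ((Metric.closedBall_subset_closedBall hn.le).trans
      (Metric.closedBall_subset_cthickening hx δ)).trans hδD
  obtain ⟨M₀, hM₀⟩ := hφ.continuous.bounded_above_of_compact_support hφ.2.1
  obtain ⟨M₁, hM₁⟩ := (hφ.continuous_fderiv_apply (EuclideanSpace.single i 1))
    |>.bounded_above_of_compact_support (hφ.hasCompactSupport_fderiv_apply _)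
  set e : Space d := EuclideanSpace.single i 1 with he
  let F : ℕ → Space d → ℝ := fun n x =>
    p x * (mollify D n b x * fderiv ℝ φ x e + mollify D n (fun y => b' y i) x * φ x)
      + p' x i * (mollify D n b x * φ x)
  have hcm : ∀ n, Continuous (mollify D n b) := fun n => (contDiff_mollify hDm hbi n).continuous
  have hcm' : ∀ n, Continuous (mollify D n fun y => b' y i) :=
    fun n => (contDiff_mollify hDm (hbi' i) n).continuous
  have hcd := hφ.continuous_fderiv_apply e
  have hcφ := hφ.continuous
  have hF0 : ∀ᶠ n in atTop, ∫ x in D, F n x = 0 := by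
    filter_upwards [hball] with n hn
    have hsm := contDiff_mollify hDm hbi n
    -- The mollified coefficient times `φ` is smooth, hence an admissible test function for the weak
    -- gradient of `p`; `b φ` itself need not be.
    have htest : IsTestFunction D fun x => mollify D n b x * φ x :=
      ⟨hsm.mul hφ.1, hφ.2.1.mul_left,
        (tsupport_mul_subset_right (f := mollify D n b) (g := φ)).trans hφ.2.2⟩
    have hder : ∀ x, fderiv ℝ (fun x => mollify D n b x * φ x) x e
        = mollify D n b x * fderiv ℝ φ x e + mollify D n (fun y => b' y i) x * φ x := by
      intro x
      have h1 := ((hsm.differentiable (by simp)) x).hasFDerivAt.mul (hφ.differentiable x).hasFDerivAt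
      have h2 : fderiv ℝ (fun x => mollify D n b x * φ x) x = _ := h1.fderiv
      rw [h2]
      simp only [add_apply, smul_apply, smul_eq_mul]
      by_cases hx : x ∈ tsupport φ
      · rw [hb.fderiv_mollify hDm hbi (hn x hx) i]
        ring
      -- Off the support the factor `φ x = 0` removes both terms in which the derivative of the
      -- mollification could differ.
      · rw [image_eq_zero_of_notMem_tsupport hx]
        ring
    have hw := hp _ htest i
    simp only [← he, hder] at hw
    have hbd : ∀ x, ‖mollify D n b x * φ x‖ ≤ c * M₀ := fun x => by
      rw [norm_mul]
      exact mul_le_mul (abs_mollify_le hDm hc hbc n x) (hM₀ x) (norm_nonneg _) hc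
    have hbd' : ∀ x, ‖mollify D n b x * fderiv ℝ φ x e
        + mollify D n (fun y => b' y i) x * φ x‖ ≤ c * M₁ + c * M₀ := fun x => by
      refine (norm_add_le _ _).trans (add_le_add ?_ ?_) <;> rw [norm_mul]
      · exact mul_le_mul (abs_mollify_le hDm hc hbc n x) (hM₁ x) (norm_nonneg _) hc
      · exact mul_le_mul (abs_mollify_le hDm hc (hbc' i) n x) (hM₀ x) (norm_nonneg _) hc
    have i1 := Integrable.mul_bdd (μ := volume.restrict D) (c := c * M₁ + c * M₀) hpi
      (((hcm n).mul hcd).add ((hcm' n).mul hcφ)).aestronglyMeasurable (Eventually.of_forall hbd')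
    have i2 := Integrable.mul_bdd (μ := volume.restrict D) (c := c * M₀) (hpi' i)
      ((hcm n).mul hcφ).aestronglyMeasurable (Eventually.of_forall hbd)
    have := integral_add i1 i2
    exact this.trans (add_eq_zero_iff_eq_neg.mpr hw)
  have hlim : Tendsto (fun n => ∫ x in D, F n x) atTop (𝓝 (∫ x in D,
      (p x * (b x * fderiv ℝ φ x e + b' x i * φ x) + p' x i * (b x * φ x)))) := by
    refine tendsto_integral_of_dominated_convergence
      (fun x => ‖p x‖ * (c * M₁ + c * M₀) + ‖p' x i‖ * (c * M₀)) ?_ ?_ ?_ ?_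
    · exact fun n => (hpi.aestronglyMeasurable.mul
        (((hcm n).mul hcd).add ((hcm' n).mul hcφ)).aestronglyMeasurable).add
        ((hpi' i).aestronglyMeasurable.mul ((hcm n).mul hcφ).aestronglyMeasurable)
    · exact (hpi.norm.mul_const _).add ((hpi' i).norm.mul_const _)
    · refine fun n => Eventually.of_forall fun x => ?_
      refine (norm_add_le _ _).trans (add_le_add ?_ ?_) <;> rw [norm_mul] <;>
        refine mul_le_mul_of_nonneg_left ?_ (norm_nonneg _)
      · refine (norm_add_le _ _).trans (add_le_add ?_ ?_) <;> rw [norm_mul]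
        · exact mul_le_mul (abs_mollify_le hDm hc hbc n x) (hM₁ x) (norm_nonneg _) hc
        · exact mul_le_mul (abs_mollify_le hDm hc (hbc' i) n x) (hM₀ x) (norm_nonneg _) hc
      · rw [norm_mul]
        exact mul_le_mul (abs_mollify_le hDm hc hbc n x) (hM₀ x) (norm_nonneg _) hc
    · filter_upwards [ae_tendsto_mollify hDm hbi, ae_tendsto_mollify hDm (hbi' i)] with x h1 h2
      exact (((h1.mul_const _).add (h2.mul_const _)).const_mul _).add
        ((h1.mul_const _).const_mul _)
  exact tendsto_nhds_unique hlim ((tendsto_congr' hF0).mpr tendsto_const_nhds)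

end Mollification

/-! ### The divergence form of the source term. -/

section SourceTerm

variable {d : ℕ} {D : Set (Space d)}

lemma ae_norm_le_norm {E : Type*} [NormedAddCommGroup E] {α : Type*} [MeasurableSpace α]
    {μ : Measure α} (f : Lp E ∞ μ) : ∀ᵐ x ∂μ, ‖f x‖ ≤ ‖f‖ := by
  filter_upwards [ae_le_eLpNormEssSup (f := f) (μ := μ)] with x hx
  rw [Lp.norm_def, eLpNorm_exponent_top, ← toReal_enorm]
  exact ENNReal.toReal_mono (by simpa using (Lp.eLpNorm_ne_top f)) hx

lemma integrableOn_coord (hDb : Bornology.IsBounded D) {ι : Type*} [Fintype ι] {q : ℝ≥0∞}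
    (hq : 1 ≤ q) (p : Lp (EuclideanSpace ℝ ι) q (volume.restrict D)) (i : ι) :
    IntegrableOn (fun x => p x i) D := by
  have : IsFiniteMeasure (volume.restrict D) := ⟨by simpa using hDb.measure_lt_top⟩
  exact ((EuclideanSpace.proj i : EuclideanSpace ℝ ι →L[ℝ] ℝ).comp_memLp' (Lp.memLp p)).integrable
    hq

lemma integrableOn_scalar (hDb : Bornology.IsBounded D) {q : ℝ≥0∞}
    (hq : 1 ≤ q) (b : Lp ℝ q (volume.restrict D)) : IntegrableOn b D := by
  have : IsFiniteMeasure (volume.restrict D) := ⟨by simpa using hDb.measure_lt_top⟩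
  exact (Lp.memLp b).integrable hq

lemma IsTestFunction.integrableOn_mul {φ : Space d → ℝ} (hφ : IsTestFunction D φ)
    {b : Space d → ℝ} (hb : IntegrableOn b D) : IntegrableOn (fun x => b x * φ x) D := by
  obtain ⟨M, hM⟩ := hφ.continuous.bounded_above_of_compact_support hφ.2.1
  exact Integrable.mul_bdd hb hφ.continuous.aestronglyMeasurable (Eventually.of_forall hM)

lemma IsTestFunction.integrableOn_mul_fderiv {φ : Space d → ℝ} (hφ : IsTestFunction D φ)
    {b : Space d → ℝ} (hb : IntegrableOn b D) (v : Space d) :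
    IntegrableOn (fun x => b x * fderiv ℝ φ x v) D := by
  obtain ⟨M, hM⟩ := (hφ.continuous_fderiv_apply v).bounded_above_of_compact_support
    (hφ.hasCompactSupport_fderiv_apply v)
  exact Integrable.mul_bdd hb (hφ.continuous_fderiv_apply v).aestronglyMeasurable
    (Eventually.of_forall hM)

lemma IsW1Inf.sub (hDb : Bornology.IsBounded D) {A A' : Jet1Inf D} (hA : IsW1Inf D A)
    (hA' : IsW1Inf D A') : IsW1Inf D (A - A') := by
  intro φ hφ i
  have e1 : ∫ x in D, (A - A').1 x * fderiv ℝ φ x (EuclideanSpace.single i 1)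
      = ∫ x in D, (A.1 x * fderiv ℝ φ x (EuclideanSpace.single i 1)
        - A'.1 x * fderiv ℝ φ x (EuclideanSpace.single i 1)) := by
    refine integral_congr_ae ?_
    filter_upwards [Lp.coeFn_sub A.1 A'.1] with x hx
    rw [Prod.fst_sub, hx, Pi.sub_apply, sub_mul]
  have e2 : ∫ x in D, (A - A').2 x i * φ x
      = ∫ x in D, (A.2 x i * φ x - A'.2 x i * φ x) := by
    refine integral_congr_ae ?_
    filter_upwards [Lp.coeFn_sub A.2 A'.2] with x hx
    rw [Prod.snd_sub, hx, Pi.sub_apply, PiLp.sub_apply, sub_mul]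
  rw [e1, e2, integral_sub (hφ.integrableOn_mul_fderiv (integrableOn_scalar hDb le_top A.1) _)
      (hφ.integrableOn_mul_fderiv (integrableOn_scalar hDb le_top A'.1) _),
    integral_sub (hφ.integrableOn_mul (integrableOn_coord hDb le_top A.2 i))
      (hφ.integrableOn_mul (integrableOn_coord hDb le_top A'.2 i)), hA φ hφ i, hA' φ hφ i]
  ring

/-- The divergence of `B p` for `B ∈ W^{1,∞}(D)` and `p ∈ L²(D)^d` with Jacobian matrix `Q`. -/
noncomputable def divProduct (B : Jet1Inf D) (p : L2Vec D) (Q : L2Mat D) (x : Space d) : ℝ :=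
  inner ℝ (B.2 x) (p x) + B.1 x * ∑ i, Q x (i, i)

/-- The factor `d` comes from the trace: each diagonal entry is at most the Frobenius norm. -/
lemma exists_divProduct (B : Jet1Inf D) (p : L2Vec D) (Q : L2Mat D) :
    ∃ F : L2 D, (F =ᵐ[volume.restrict D] divProduct B p Q) ∧
      ‖F‖ ≤ ‖B‖ * (‖p‖ + d * ‖Q‖) := by
  have hb1 : ∀ᵐ x ∂(volume.restrict D), ‖(inner ℝ (B.2 x) (p x) : ℝ)‖ ≤ ‖B‖ * ‖p x‖ := by
    filter_upwards [ae_norm_le_norm B.2] with x hx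
    exact (norm_inner_le_norm _ _).trans (by gcongr; exact hx.trans (norm_snd_le B))
  have hb2 : ∀ᵐ x ∂(volume.restrict D), ‖B.1 x * ∑ i, Q x (i, i)‖ ≤ ‖B‖ * d * ‖Q x‖ := by
    filter_upwards [ae_norm_le_norm B.1] with x hx
    rw [norm_mul, mul_assoc]
    refine mul_le_mul (hx.trans (norm_fst_le B)) ?_ (norm_nonneg _) (norm_nonneg _)
    refine (norm_sum_le_of_le _ fun i _ => PiLp.norm_apply_le (Q x) (i, i)).trans ?_
    simp
  have hmQ : AEStronglyMeasurable (fun x => ∑ i, Q x (i, i)) (volume.restrict D) := by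
    have : Continuous fun q : EuclideanSpace ℝ (Fin d × Fin d) => ∑ i, q (i, i) := by fun_prop
    exact this.comp_aestronglyMeasurable (Lp.aestronglyMeasurable Q)
  have m1 : MemLp (fun x => (inner ℝ (B.2 x) (p x) : ℝ)) 2 (volume.restrict D) :=
    (Lp.memLp p).of_le_mul
      ((Lp.aestronglyMeasurable B.2).inner (Lp.aestronglyMeasurable p)) hb1
  have m2 : MemLp (fun x => B.1 x * ∑ i, Q x (i, i)) 2 (volume.restrict D) :=
    (Lp.memLp Q).of_le_mul ((Lp.aestronglyMeasurable B.1).mul hmQ) hb2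
  refine ⟨m1.toLp _ + m2.toLp _, ?_, ?_⟩
  · filter_upwards [Lp.coeFn_add (m1.toLp _) (m2.toLp _), m1.coeFn_toLp, m2.coeFn_toLp]
      with x h1 h2 h3
    rw [h1, Pi.add_apply, h2, h3, divProduct]
  · refine (norm_add_le _ _).trans ?_
    rw [mul_add, ← mul_assoc]
    refine add_le_add (Lp.norm_le_mul_norm_of_ae_le_mul ?_) (Lp.norm_le_mul_norm_of_ae_le_mul ?_)
    · filter_upwards [m1.coeFn_toLp, hb1] with x h1 h2
      rwa [h1]
    · filter_upwards [m2.coeFn_toLp, hb2] with x h1 h2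
      rwa [h1]

lemma norm_fst_le_jet2 (U : Jet2 D) : ‖U.fst‖ ≤ ‖U‖ :=
  abs_le_of_sq_le_sq' (by rw [WithLp.prod_norm_sq_eq_of_L2 U]; nlinarith [sq_nonneg ‖U.snd‖])
    (norm_nonneg _) |>.2

lemma norm_snd_le_jet2 (U : Jet2 D) : ‖U.snd‖ ≤ ‖U‖ :=
  abs_le_of_sq_le_sq' (by rw [WithLp.prod_norm_sq_eq_of_L2 U]; nlinarith [sq_nonneg ‖U.fst‖])
    (norm_nonneg _) |>.2

/-- For `B ∈ W^{1,∞}(D)` and `w ∈ H²(D) ∩ H¹₀(D)` the functional `a(B; w, ·)` is represented by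
an `L²(D)`-function. -/
theorem exists_functional_eq_bilin (hD : IsOpen D) (hDb : Bornology.IsBounded D) {B : Jet1Inf D}
    (hB : IsW1Inf D B) {U : Jet2 D} (hU : IsH2 D U) {w : H10 D} (hw : U.fst = (w : Jet1 D)) :
    ∃ F : L2 D, ‖F‖ ≤ (1 + d) * ‖B‖ * ‖U‖ ∧ ∀ v : H10 D, bilin B.1 w v = functional F v := by
  obtain ⟨F, hF, hFn⟩ := exists_divProduct B (grad D w) U.snd
  have hpU : ‖grad D w‖ ≤ ‖U‖ :=
    (norm_grad_le w).trans (le_of_eq_of_le (by rw [hw]; rfl) (norm_fst_le_jet2 U))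
  refine ⟨-F, ?_, ?_⟩
  · rw [norm_neg]
    refine hFn.trans ?_
    have : ‖grad D w‖ + d * ‖U.snd‖ ≤ (1 + d) * ‖U‖ := by
      have : d * ‖U.snd‖ ≤ d * ‖U‖ := by gcongr; exact norm_snd_le_jet2 U
      linarith
    calc ‖B‖ * (‖grad D w‖ + d * ‖U.snd‖) ≤ ‖B‖ * ((1 + d) * ‖U‖) := by gcongr
      _ = _ := by ring
  intro v
  rw [bilin_eq_inner, functional_eq_inner]
  refine H10_induction (D := D) (p := fun v => inner ℝ (B.1 • grad D w : L2Vec D) v.snd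
    = inner ℝ (-F) v.fst) ?_ ?_ v
  · exact isClosed_eq
      (continuous_const.inner (WithLp.sndL 2 ℝ (L2 D) (L2Vec D)).continuous)
      (continuous_const.inner (WithLp.fstL 2 ℝ (L2 D) (L2Vec D)).continuous)
  rintro z ⟨φ, hφ, h1, h2⟩
  -- `G i` is the integrand of the product rule with `b = B` and `p = ∂_i w`. The sum over `i` is `B
  -- ∇w · ∇φ + div(B ∇w) φ`, so its vanishing integral is the claim.
  let G : Fin d → Space d → ℝ := fun i x =>
    grad D w x i * (B.1 x * fderiv ℝ φ x (EuclideanSpace.single i 1) + B.2 x i * φ x)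
      + U.snd x (i, i) * (B.1 x * φ x)
  have hpw : ∀ i, HasWeakGradient D (fun x => grad D w x i)
      (fun x => WithLp.toLp 2 fun j => U.snd x (i, j)) := by
    have := hU.2
    rwa [hw] at this
  have hb1 : ∀ᵐ x ∂(volume.restrict D), |B.1 x| ≤ ‖B‖ := by
    filter_upwards [ae_norm_le_norm B.1] with x hx
    exact hx.trans (norm_fst_le B)
  have hb2 : ∀ i, ∀ᵐ x ∂(volume.restrict D), |B.2 x i| ≤ ‖B‖ := by
    intro i
    filter_upwards [ae_norm_le_norm B.2] with x hx
    exact ((PiLp.norm_apply_le (B.2 x) i).trans hx).trans (norm_snd_le B)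
  have hG0 : ∀ i, ∫ x in D, G i x = 0 := fun i =>
    hB.integral_product hD (hpw i) (norm_nonneg B) (integrableOn_scalar hDb le_top B.1)
      (integrableOn_coord hDb le_top B.2) hb1 hb2
      (integrableOn_coord hDb one_le_two (grad D w) i)
      (fun j => integrableOn_coord hDb one_le_two U.snd (i, j)) hφ i
  have hGi : ∀ i, IntegrableOn (G i) D := fun i =>
    integrable_product (p' := fun x => WithLp.toLp 2 fun j => U.snd x (i, j))
      (norm_nonneg B) (integrableOn_scalar hDb le_top B.1)
      (integrableOn_coord hDb le_top B.2) hb1 hb2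
      (integrableOn_coord hDb one_le_two (grad D w) i)
      (fun j => integrableOn_coord hDb one_le_two U.snd (i, j)) hφ i
  have key : ∫ x in D, ∑ i, G i x = 0 := by
    rw [integral_finsetSum _ fun i _ => hGi i, Finset.sum_eq_zero fun i _ => hG0 i]
  rw [inner_neg_left, ← add_eq_zero_iff_eq_neg, L2.inner_def, L2.inner_def,
    ← integral_add (L2.integrable_inner _ _) (L2.integrable_inner _ _), ← key]
  refine integral_congr_ae ?_
  filter_upwards [h1, h2, hF, Lp.coeFn_lpSMul (r := 2) B.1 (grad D w)] with x e1 e2 e3 e4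
  rw [e1, e2, e3, e4, Pi.smul_apply', real_inner_smul_left, divProduct]
  simp only [PiLp.inner_apply, RCLike.inner_apply, conj_trivial, gradient_apply_eq_fderiv, G,
    Finset.sum_add_distrib, Finset.mul_sum, mul_add]
  rw [← add_assoc]
  congr 1
  · congr 1
    · exact Finset.sum_congr rfl fun i _ => by ring
    · exact Finset.sum_congr rfl fun i _ => by ring
  · exact Finset.sum_congr rfl fun i _ => by ring

end SourceTerm

/-! ### Galerkin errors, increments and their dependence on the coefficient. -/

section Galerkin

variable {d : ℕ} {D : Set (Space d)}

/-- **Céa's lemma** with respect to the gradient norm. -/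
theorem norm_grad_sub_le_of_orthogonal {A : Lp ℝ ∞ (volume.restrict D)} {a b : ℝ} (ha : 0 < a)
    (hb : 0 < b) (hA : ∀ᵐ x ∂(volume.restrict D), a ≤ A x ∧ A x ≤ b)
    {X : Submodule ℝ (H10 D)} {u uX w : H10 D} (huX : uX ∈ X) (hw : w ∈ X)
    (h : ∀ v ∈ X, bilin A (u - uX) v = 0) :
    ‖grad D (u - uX)‖ ≤ √(b / a) * ‖grad D (u - w)‖ := by
  have h1 := le_bilin_self (hA.mono fun _ hx => hx.1) (u - uX)
  have h2 := bilin_self_le (hA.mono fun _ hx => hx.2) (u - w)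
  have h3 := le_bilin_self (hA.mono fun _ hx => hx.1) (w - uX)
  have h4 := h _ (X.sub_mem hw huX)
  -- Pythagoras in the energy, where the mixed term vanishes by `h4`. The symmetry of the form is
  -- what gives the factor `√(b / a)` rather than `b / a`.
  have h5 : bilin A (u - w) (u - w) = bilin A (u - uX) (u - uX)
      - 2 * bilin A (u - uX) (w - uX) + bilin A (w - uX) (w - uX) := by
    have e : u - w = (u - uX) - (w - uX) := by abel
    rw [e, bilin_sub_left, bilin_sub_right A (u - uX), bilin_sub_right A (w - uX),
      bilin_symm A (w - uX) (u - uX)]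
    ring
  have h6 : 0 ≤ a * ‖grad D (w - uX)‖ ^ 2 := by positivity
  refine abs_le_of_sq_le_sq' ?_ (by positivity) |>.2
  rw [mul_pow, Real.sq_sqrt (by positivity), div_mul_eq_mul_div, le_div_iff₀ ha]
  linarith

/-- A coefficient in `W^{1,∞}(D)` with values in `[a, b]` whose solution operator satisfies the
`H²(D)`-regularity estimate. -/
structure IsRegularCoefficient (D : Set (Space d)) (Creg a b : ℝ) (A : Jet1Inf D) : Prop where
  w1inf : IsW1Inf D A
  bounds : ∀ᵐ x ∂(volume.restrict D), a ≤ A.1 x ∧ A.1 x ≤ b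
  regularity : ∀ F : L2 D, ∃ U : Jet2 D, IsH2 D U ∧ U.fst = (solution ⊤ A.1 F : Jet1 D) ∧
    ‖U‖ ≤ Creg / a ^ 2 * (1 + ‖A‖) * ‖F‖

lemma IsRandomCoefficient.isRegularCoefficient {Creg a b : ℝ} {Ω : Type*} [MeasurableSpace Ω]
    {P : Measure Ω} {Ω₀ : Set Ω} {A : ℕ → Ω → Jet1Inf D}
    (h : IsRandomCoefficient D Creg a b P Ω₀ A) {ω : Ω} (hω : ω ∈ Ω₀) (ν : ℕ) :
    IsRegularCoefficient D Creg a b (A ν ω) :=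
  ⟨h.w1inf ω hω ν, h.bounds ω hω ν, h.regularity ω hω ν⟩

instance : CompleteSpace (⊤ : Submodule ℝ (H10 D)) :=
  IsClosed.completeSpace_coe (hs := isClosed_univ)

section Solution

variable {K a b Creg Capprox Cunif : ℝ} (hK : ∀ v : H10 D, ‖toL2 D v‖ ≤ K * ‖grad D v‖)
  (ha : 0 < a) (hb : 0 < b)
include hK ha

lemma IsRegularCoefficient.isGalerkinSolution {A : Jet1Inf D}
    (hA : IsRegularCoefficient D Creg a b A) (X : Submodule ℝ (H10 D)) [CompleteSpace X]
    (f : L2 D) : IsGalerkinSolution X A.1 f (solution X A.1 f) :=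
  isGalerkinSolution_solution hK ha (hA.bounds.mono fun _ hx => hx.1) X f

include hb

/-- The error of the Galerkin solution, with an arbitrary bound of the `H²(D)`-norm. -/
lemma IsRegularCoefficient.norm_grad_error_le {A : Jet1Inf D}
    (hA : IsRegularCoefficient D Creg a b A) (X : Submodule ℝ (H10 D)) [CompleteSpace X]
    (f : L2 D) {τ : ℝ} (hτ : 0 ≤ τ) (happ : ∀ w : H10 D, ∀ U : Jet2 D, IsH2 D U →
      U.fst = (w : Jet1 D) → ⨅ v : X, ‖w - (v : H10 D)‖ ≤ τ * ‖U‖) :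
    ‖grad D (solution ⊤ A.1 f - solution X A.1 f)‖
      ≤ √(b / a) * (τ * (Creg / a ^ 2 * (1 + ‖A‖) * ‖f‖)) := by
  obtain ⟨U, hU, hUw, hUn⟩ := hA.regularity f
  have hs : 0 < √(b / a) := Real.sqrt_pos.mpr (by positivity)
  have hX := hA.isGalerkinSolution hK ha X f
  have htop := hA.isGalerkinSolution hK ha ⊤ f
  -- With the constant moved to the left, the bound passes to the infimum over `w` without a best
  -- approximation being chosen.
  have hcea : ∀ w : X, ‖grad D (solution ⊤ A.1 f - solution X A.1 f)‖ / √(b / a)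
      ≤ ‖solution ⊤ A.1 f - (w : H10 D)‖ := by
    intro w
    rw [div_le_iff₀' hs]
    refine (norm_grad_sub_le_of_orthogonal ha hb hA.bounds hX.1 w.2 fun v hv => ?_).trans
      (mul_le_mul_of_nonneg_left (norm_grad_le _) hs.le)
    rw [bilin_sub_left, htop.2 v Submodule.mem_top, hX.2 v hv, sub_self]
  have h := (le_ciInf hcea).trans (happ _ U hU hUw)
  rw [div_le_iff₀' hs] at h
  exact h.trans (by gcongr)

variable {X : ℕ → Submodule ℝ (H10 D)} {h : ℕ → ℝ}

lemma IsRegularCoefficient.norm_grad_error_le_mesh {A : Jet1Inf D}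
    (hA : IsRegularCoefficient D Creg a b A) (hX : IsFEHierarchy D Capprox Cunif X h)
    (hCapprox : 0 ≤ Capprox) (l : ℕ) (f : L2 D) :
    ‖grad D (solution ⊤ A.1 f - solution (X l) A.1 f)‖
      ≤ √(b / a) * (Capprox * h l * (Creg / a ^ 2 * (1 + ‖A‖) * ‖f‖)) := by
  have := hX.finiteDimensional l
  have : CompleteSpace (X l) := FiniteDimensional.complete ℝ (X l)
  exact hA.norm_grad_error_le hK ha hb (X l) f
    (mul_nonneg hCapprox (hX.mesh_pos l).le) (hX.approx l)

/-- Both levels are compared with the exact solution. `H` stands for a common bound of the fine and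
the coarse mesh width, to be chosen at the end. -/
lemma IsRegularCoefficient.norm_grad_increment_le {A : Jet1Inf D}
    (hA : IsRegularCoefficient D Creg a b A) (hX : IsFEHierarchy D Capprox Cunif X h)
    (hCapprox : 0 ≤ Capprox) (hCreg : 0 ≤ Creg) {l : ℕ} {H : ℝ} (h1 : h l ≤ H)
    (h2 : h (l - 1) ≤ H) (f : L2 D) :
    ‖grad D (solution (X l) A.1 f - solution (X (l - 1)) A.1 f)‖
      ≤ 2 * √(b / a) * Capprox * H * Creg / a ^ 2 * (1 + ‖A‖) * ‖f‖ := by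
  have e1 := hA.norm_grad_error_le_mesh hK ha hb hX hCapprox l f
  have e2 := hA.norm_grad_error_le_mesh hK ha hb hX hCapprox (l - 1) f
  have e3 : √(b / a) * (Capprox * h l * (Creg / a ^ 2 * (1 + ‖A‖) * ‖f‖))
    ≤ √(b / a) * (Capprox * H * (Creg / a ^ 2 * (1 + ‖A‖) * ‖f‖)) := by gcongr
  have e4 : √(b / a) * (Capprox * h (l - 1) * (Creg / a ^ 2 * (1 + ‖A‖) * ‖f‖))
    ≤ √(b / a) * (Capprox * H * (Creg / a ^ 2 * (1 + ‖A‖) * ‖f‖)) := by gcongr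
  have e5 : solution (X l) A.1 f - solution (X (l - 1)) A.1 f
      = (solution ⊤ A.1 f - solution (X (l - 1)) A.1 f)
        - (solution ⊤ A.1 f - solution (X l) A.1 f) := by abel
  rw [e5, map_sub]
  refine (norm_sub_le _ _).trans ((add_le_add (e2.trans e4) (e1.trans e3)).trans (le_of_eq ?_))
  ring

/-- The Galerkin error of the difference of the solutions for two coefficients. -/
lemma IsRegularCoefficient.norm_grad_error_sub_le {A A' : Jet1Inf D}
    (hD : IsOpen D) (hDb : Bornology.IsBounded D)
    (hA : IsRegularCoefficient D Creg a b A) (hA' : IsRegularCoefficient D Creg a b A')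
    (hX : IsFEHierarchy D Capprox Cunif X h) (hCapprox : 0 ≤ Capprox) (hCreg : 0 ≤ Creg)
    (l : ℕ) (f : L2 D) :
    ‖grad D ((solution ⊤ A.1 f - solution ⊤ A'.1 f)
        - (solution (X l) A.1 f - solution (X l) A'.1 f))‖
      ≤ √(b / a) * Capprox * h l * ‖A - A'‖ * (Creg / a ^ 2 * (1 + ‖A'‖) * ‖f‖)
        * ((1 + d) * (Creg / a ^ 2 * (1 + ‖A‖)) + a⁻¹) := by
  have := hX.finiteDimensional l
  have : CompleteSpace (X l) := FiniteDimensional.complete ℝ (X l)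
  have hl := (hX.mesh_pos l).le
  obtain ⟨U, hU, hUw, hUn⟩ := hA'.regularity f
  obtain ⟨F, hFn, hF⟩ := exists_functional_eq_bilin hD hDb (hA.w1inf.sub hDb hA'.w1inf) hU hUw
  rw [Prod.fst_sub] at hF
  set u := solution ⊤ A.1 f with hu
  set u' := solution ⊤ A'.1 f with hu'
  set ul := solution (X l) A.1 f with hul
  set ul' := solution (X l) A'.1 f with hul'
  have su := hA.isGalerkinSolution hK ha ⊤ f
  have su' := hA'.isGalerkinSolution hK ha ⊤ f
  have sul := hA.isGalerkinSolution hK ha (X l) f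
  have sul' := hA'.isGalerkinSolution hK ha (X l) f
  rw [← hu] at su
  rw [← hu'] at su'
  rw [← hul] at sul
  rw [← hul'] at sul'
  have hneg : ∀ v, functional (-F) v = - functional F v := fun v => by
    simp only [functional_eq_inner, inner_neg_left]
  -- Subtracting the two equations gives `a(A; u - u', v) = -a(A - A'; u', v)`, and `F` represents
  -- the functional on the right without its sign. Thus regularity for `A` applies to `u - u'`.
  have he : u - u' = solution ⊤ A.1 (-F) := by
    refine IsGalerkinSolution.unique hK ha (hA.bounds.mono fun _ hx => hx.1)
      ⟨Submodule.mem_top, fun v hv => ?_⟩ (hA.isGalerkinSolution hK ha ⊤ (-F))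
    rw [hneg, ← hF, bilin_sub_coeff, bilin_sub_left, su.2 v hv, su'.2 v hv]
    ring
  set w := solution (X l) A.1 (-F) with hw
  have sw := hA.isGalerkinSolution hK ha (X l) (-F)
  rw [← hw] at sw
  have e1 := hA.norm_grad_error_le_mesh hK ha hb hX hCapprox l (-F)
  rw [← he, ← hw, norm_neg] at e1
  have e2 := hA'.norm_grad_error_le_mesh hK ha hb hX hCapprox l f
  rw [← hu', ← hul'] at e2
  have hmem : w - (ul - ul') ∈ X l := (X l).sub_mem sw.1 ((X l).sub_mem sul.1 sul'.1)
  -- `ul - ul'` is not the Galerkin projection `w` of `u - u'`, since its equation carries `ul'` in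
  -- place of `u'` on the right. The discrepancy is tested with itself.
  have e3 : ‖grad D (w - (ul - ul'))‖ ≤ a⁻¹ * (‖A - A'‖ * ‖grad D (u' - ul')‖) := by
    have i1 := le_bilin_self (hA.bounds.mono fun _ hx => hx.1) (w - (ul - ul'))
    have i2 : bilin A.1 (w - (ul - ul')) (w - (ul - ul'))
        = - bilin (A.1 - A'.1) (u' - ul') (w - (ul - ul')) := by
      rw [bilin_sub_left A.1 w, bilin_sub_left A.1 ul, sw.2 _ hmem, sul.2 _ hmem, hneg, ← hF,
        bilin_sub_left (A.1 - A'.1) u', bilin_sub_coeff A.1 A'.1 ul', sul'.2 _ hmem]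
      ring
    have i3 := abs_bilin_le (A.1 - A'.1) (u' - ul') (w - (ul - ul'))
    have i4 : ‖A.1 - A'.1‖ ≤ ‖A - A'‖ := norm_fst_le (A - A')
    rw [i2] at i1
    have i5 : a * ‖grad D (w - (ul - ul'))‖ ^ 2
        ≤ ‖A - A'‖ * ‖grad D (u' - ul')‖ * ‖grad D (w - (ul - ul'))‖ :=
      (i1.trans (neg_le_abs _)).trans (i3.trans (by gcongr))
    rw [← div_eq_inv_mul, le_div_iff₀' ha]
    -- One factor of the norm is cancelled from `i5`, which requires it to be nonzero.
    rcases (norm_nonneg (grad D (w - (ul - ul')))).eq_or_lt with h0 | h0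
    · rw [← h0, mul_zero]
      positivity
    · refine le_of_mul_le_mul_right ?_ h0
      linarith
  have e4 : (u - u') - (ul - ul') = (u - u' - w) + (w - (ul - ul')) := by abel
  rw [e4, map_add]
  have hFn' : ‖F‖ ≤ (1 + d) * ‖A - A'‖ * (Creg / a ^ 2 * (1 + ‖A'‖) * ‖f‖) :=
    hFn.trans (by gcongr)
  calc ‖grad D (u - u' - w) + grad D (w - (ul - ul'))‖
      ≤ √(b / a) * (Capprox * h l * (Creg / a ^ 2 * (1 + ‖A‖)
          * ((1 + d) * ‖A - A'‖ * (Creg / a ^ 2 * (1 + ‖A'‖) * ‖f‖))))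
        + a⁻¹ * (‖A - A'‖ * (√(b / a) * (Capprox * h l
          * (Creg / a ^ 2 * (1 + ‖A'‖) * ‖f‖)))) := by
        refine (norm_add_le _ _).trans (add_le_add (e1.trans ?_) (e3.trans ?_))
        · gcongr
        · gcongr
    _ = _ := by ring

/-- The double difference is the difference, between the two levels, of the Galerkin errors of `u -
u'`; each of them carries both a mesh width and `‖A - A'‖`. -/
lemma IsRegularCoefficient.norm_grad_double_difference_le {A A' : Jet1Inf D}
    (hD : IsOpen D) (hDb : Bornology.IsBounded D) (ha1 : a ≤ 1)
    (hA : IsRegularCoefficient D Creg a b A) (hA' : IsRegularCoefficient D Creg a b A')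
    (hX : IsFEHierarchy D Capprox Cunif X h) (hCapprox : 0 ≤ Capprox) (hCreg : 0 ≤ Creg)
    {l : ℕ} {H : ℝ} (h1 : h l ≤ H) (h2 : h (l - 1) ≤ H) (f : L2 D) :
    ‖grad D ((solution (X l) A.1 f - solution (X (l - 1)) A.1 f)
        - (solution (X l) A'.1 f - solution (X (l - 1)) A'.1 f))‖
      ≤ 2 * √(b / a) * Capprox * H * Creg / a ^ 2 * ‖A - A'‖ * (((1 + d) * Creg + 1) / a ^ 2)
        * ((1 + ‖A‖) * (1 + ‖A'‖)) * ‖f‖ := by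
  -- The regularity part and the perturbation part are merged into one power of `a`; this uses `a ≤
  -- 1`.
  have e0 : (1 + d) * (Creg / a ^ 2 * (1 + ‖A‖)) + a⁻¹
      ≤ ((1 + d) * Creg + 1) / a ^ 2 * (1 + ‖A‖) := by
    have : a⁻¹ ≤ 1 / a ^ 2 * (1 + ‖A‖) := by
      rw [div_mul_eq_mul_div, one_mul, le_div_iff₀ (by positivity), pow_two,
        inv_mul_cancel_left₀ ha.ne']
      linarith [norm_nonneg A]
    have e : ((1 + d) * Creg + 1) / a ^ 2 * (1 + ‖A‖)
      = (1 + d) * (Creg / a ^ 2 * (1 + ‖A‖)) + 1 / a ^ 2 * (1 + ‖A‖) := by ring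
    rw [e]
    gcongr
  have e1 := hA.norm_grad_error_sub_le hK ha hb hD hDb hA' hX hCapprox hCreg l f
  have e2 := hA.norm_grad_error_sub_le hK ha hb hD hDb hA' hX hCapprox hCreg (l - 1) f
  have hle : ∀ t, 0 ≤ t → t ≤ H →
      √(b / a) * Capprox * t * ‖A - A'‖ * (Creg / a ^ 2 * (1 + ‖A'‖) * ‖f‖)
        * ((1 + d) * (Creg / a ^ 2 * (1 + ‖A‖)) + a⁻¹)
      ≤ √(b / a) * Capprox * H * ‖A - A'‖ * (Creg / a ^ 2 * (1 + ‖A'‖) * ‖f‖)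
        * (((1 + d) * Creg + 1) / a ^ 2 * (1 + ‖A‖)) := by
    intro t ht0 ht
    have := ht0.trans ht
    gcongr
  have e3 := e1.trans (hle _ (hX.mesh_pos l).le h1)
  have e4 := e2.trans (hle _ (hX.mesh_pos (l - 1)).le h2)
  have e5 : (solution (X l) A.1 f - solution (X (l - 1)) A.1 f)
        - (solution (X l) A'.1 f - solution (X (l - 1)) A'.1 f)
      = ((solution ⊤ A.1 f - solution ⊤ A'.1 f)
          - (solution (X (l - 1)) A.1 f - solution (X (l - 1)) A'.1 f))
        - ((solution ⊤ A.1 f - solution ⊤ A'.1 f)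
          - (solution (X l) A.1 f - solution (X l) A'.1 f)) := by abel
  rw [e5, map_sub]
  refine (norm_sub_le _ _).trans ((add_le_add e4 e3).trans (le_of_eq ?_))
  ring

omit hb in
/-- The duality argument for the increments of the Galerkin solutions. -/
lemma IsRegularCoefficient.functional_increment {A : Jet1Inf D}
    (hA : IsRegularCoefficient D Creg a b A) (hX : IsFEHierarchy D Capprox Cunif X h)
    (l : ℕ) (f g : L2 D) :
    functional g (solution (X l) A.1 f - solution (X (l - 1)) A.1 f)
      = bilin A.1 (solution (X l) A.1 f - solution (X (l - 1)) A.1 f)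
          (solution (X l) A.1 g - solution (X (l - 1)) A.1 g) := by
  have := hX.finiteDimensional l
  have : CompleteSpace (X l) := FiniteDimensional.complete ℝ (X l)
  have := hX.finiteDimensional (l - 1)
  have : CompleteSpace (X (l - 1)) := FiniteDimensional.complete ℝ (X (l - 1))
  have hsub : X (l - 1) ≤ X l := hX.nested (Nat.sub_le l 1)
  have u1 := hA.isGalerkinSolution hK ha (X l) f
  have u0 := hA.isGalerkinSolution hK ha (X (l - 1)) f
  have z1 := hA.isGalerkinSolution hK ha (X l) g
  have z0 := hA.isGalerkinSolution hK ha (X (l - 1)) g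
  have hdu := (X l).sub_mem u1.1 (hsub u0.1)
  -- Galerkin orthogonality: by nestedness the coarse dual solution is admissible in both discrete
  -- equations.
  have h0 : bilin A.1 (solution (X l) A.1 f - solution (X (l - 1)) A.1 f)
      (solution (X (l - 1)) A.1 g) = 0 := by
    rw [bilin_sub_left, u1.2 _ (hsub z0.1), u0.2 _ z0.1, sub_self]
  rw [bilin_sub_right, h0, sub_zero, bilin_symm, z1.2 _ hdu]

end Solution

end Galerkin

/-! ### Bookkeeping of the constants and the estimate for two coefficients. -/

section GoalFunctional

variable {d : ℕ} {D : Set (Space d)}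

/-- The factor `b / a ^ 5` is the one produced by the product of two increment bounds. The rest is
room for the remaining powers of the norms and of `a⁻¹`. -/
lemma goalConst_eq (a b N N' : ℝ) : goalConst a b N N'
    = b / a ^ 5 * (N * N' * (√b / a ^ 5) * (1 + max N N') ^ 2) := by
  unfold goalConst prodConst
  ring

/-- From `a² ≤ a ≤ b` follows `a ≤ √b`, so the root of the upper bound costs at most one power of
`a`. -/
lemma inv_pow_four_le {a b : ℝ} (ha : 0 < a) (ha1 : a ≤ 1) (hab : a ≤ b) :
    a⁻¹ ^ 4 ≤ √b / a ^ 5 := by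
  have hs : a ≤ √b := Real.le_sqrt_of_sq_le (by nlinarith)
  rw [le_div_iff₀ (by positivity)]
  refine le_of_eq_of_le ?_ hs
  field_simp

lemma mul_sq_le_goalConst {a b N N' L n : ℝ} (hab : 0 < b / a ^ 5) (hn0 : 0 ≤ n)
    (hn : n ≤ 1 + max N N') (hL : 0 ≤ L) (hLq : L ≤ N * N' * (√b / a ^ 5)) :
    b / a ^ 5 * (L * n ^ 2) ≤ goalConst a b N N' := by
  rw [goalConst_eq]
  have := hL.trans hLq
  gcongr

/-- Cubic terms must fit below a squared maximum. One linear factor is traded for `2 N a⁻¹`, using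
`1 ≤ a⁻¹` and `1 ≤ N a⁻¹`; the factor `N` it leaves is one of those in `goalConst`. -/
lemma mul_cube_le {a N N' : ℝ} (ha : 0 < a) (ha1 : a ≤ 1) (hN : a ≤ N) (hN' : a ≤ N') :
    (1 + N) ^ 2 * (1 + N') ≤ 2 * N * a⁻¹ * (1 + max N N') ^ 2 ∧
      (1 + N) * (1 + N') ^ 2 ≤ 2 * N * a⁻¹ * (1 + max N N') ^ 2 := by
  have hN0 := ha.trans_le hN
  have hN0' := ha.trans_le hN'
  have h1 : 1 + N ≤ 2 * N * a⁻¹ := by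
    rw [← div_eq_mul_inv, le_div_iff₀ ha]
    nlinarith
  rcases le_total N N' with h | h
  · rw [max_eq_right h]
    constructor
    · calc (1 + N) ^ 2 * (1 + N') = (1 + N) * ((1 + N) * (1 + N')) := by ring
        _ ≤ (2 * N * a⁻¹) * ((1 + N') * (1 + N')) := by gcongr
        _ = _ := by ring
    · gcongr
  · rw [max_eq_left h]
    constructor
    · calc (1 + N) ^ 2 * (1 + N') ≤ (1 + N) ^ 2 * (2 * N * a⁻¹) := by
            gcongr
            linarith
        _ = _ := by ring
    · gcongr

lemma mul_cube_le_goalConst {a b N N' t : ℝ} (ha : 0 < a) (ha1 : a ≤ 1) (hab : a ≤ b)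
    (hN : 0 ≤ N) (hN' : 0 ≤ N') (ht : t ≤ 2 * N * a⁻¹ * (1 + max N N') ^ 2) :
    b / a ^ 5 * (N' * (t / a ^ 2)) ≤ 2 * goalConst a b N N' := by
  have hb := ha.trans_le hab
  have hr : 1 ≤ a⁻¹ := (one_le_inv₀ ha).mpr ha1
  have h3 : a⁻¹ ^ 3 ≤ √b / a ^ 5 :=
    (pow_le_pow_right₀ hr (by norm_num)).trans (inv_pow_four_le ha ha1 hab)
  calc b / a ^ 5 * (N' * (t / a ^ 2))
      ≤ b / a ^ 5 * (N' * (2 * N * a⁻¹ * (1 + max N N') ^ 2 / a ^ 2)) := by gcongr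
    _ = 2 * (b / a ^ 5 * (N * N' * a⁻¹ ^ 3 * (1 + max N N') ^ 2)) := by
        field_simp
    _ ≤ 2 * (b / a ^ 5 * (N * N' * (√b / a ^ 5) * (1 + max N N') ^ 2)) := by gcongr
    _ = _ := by rw [goalConst_eq]

/-- The norms may be as small as `a`; the spare powers of `a⁻¹` make up for this. -/
lemma one_le_mul_of_le {a b N N' : ℝ} (ha : 0 < a) (ha1 : a ≤ 1) (hab : a ≤ b) (hN : a ≤ N)
    (hN' : a ≤ N') : 1 ≤ N * N' * (√b / a ^ 5) ∧ N ≤ N * N' * (√b / a ^ 5) ∧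
      N' ≤ N * N' * (√b / a ^ 5) := by
  have hr : 1 ≤ a⁻¹ := (one_le_inv₀ ha).mpr ha1
  have hN0 := ha.trans_le hN
  have hN0' := ha.trans_le hN'
  have h4 := inv_pow_four_le ha ha1 hab
  have key : ∀ M, a ≤ M → 1 ≤ M * (√b / a ^ 5) := by
    intro M hM
    calc 1 = a * a⁻¹ := (mul_inv_cancel₀ ha.ne').symm
      _ ≤ M * (√b / a ^ 5) := by
        have := (le_self_pow₀ hr (n := 4) (by norm_num)).trans h4
        have := ha.trans_le hM
        gcongr
  refine ⟨?_, ?_, ?_⟩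
  · calc 1 = a * a⁻¹ * (a * a⁻¹) := by rw [mul_inv_cancel₀ ha.ne', one_mul]
      _ = a * a * a⁻¹ ^ 2 := by ring
      _ ≤ N * N' * (√b / a ^ 5) := by
        have := (pow_le_pow_right₀ hr (show 2 ≤ 4 by norm_num)).trans h4
        gcongr
  · nlinarith [key N' hN']
  · nlinarith [key N hN]

/-- Used when the minimum is `1`: the two terms are bounded separately and no cancellation is
exploited. -/
lemma abs_bilin_sub_bilin_le (A A' : Jet1Inf D) {du du' dz dz' : H10 D} {κ n n' x y : ℝ}
    (bu : ‖grad D du‖ ≤ κ * n * x) (bz : ‖grad D dz‖ ≤ κ * n * y)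
    (bu' : ‖grad D du'‖ ≤ κ * n' * x) (bz' : ‖grad D dz'‖ ≤ κ * n' * y) :
    |bilin A.1 du dz - bilin A'.1 du' dz'|
      ≤ κ ^ 2 * (‖A‖ * n ^ 2 + ‖A'‖ * n' ^ 2) * (x * y) := by
  have nA : ‖A.1‖ ≤ ‖A‖ := norm_fst_le A
  have nA' : ‖A'.1‖ ≤ ‖A'‖ := norm_fst_le A'
  have pu := (norm_nonneg _).trans bu
  have pu' := (norm_nonneg _).trans bu'
  calc |bilin A.1 du dz - bilin A'.1 du' dz'|
      ≤ |bilin A.1 du dz| + |bilin A'.1 du' dz'| := abs_sub _ _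
    _ ≤ ‖A‖ * (κ * n * x) * (κ * n * y) + ‖A'‖ * (κ * n' * x) * (κ * n' * y) := by
        refine add_le_add ((abs_bilin_le _ _ _).trans ?_) ((abs_bilin_le _ _ _).trans ?_)
        · gcongr
        · gcongr
    _ = _ := by ring

/-- Telescoping changes the coefficient, the primal increment and the dual increment one at a time,
and each change contributes one factor `‖A - A'‖`. -/
lemma abs_bilin_sub_bilin_le_mul (A A' : Jet1Inf D) {du du' dz dz' : H10 D}
    {κ Λ n n' x y : ℝ}
    (bu : ‖grad D du‖ ≤ κ * n * x) (bz : ‖grad D dz‖ ≤ κ * n * y)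
    (bu' : ‖grad D du'‖ ≤ κ * n' * x)
    (bdu : ‖grad D (du - du')‖ ≤ κ * ‖A - A'‖ * Λ * (n * n') * x)
    (bdz : ‖grad D (dz - dz')‖ ≤ κ * ‖A - A'‖ * Λ * (n * n') * y) :
    |bilin A.1 du dz - bilin A'.1 du' dz'|
      ≤ κ ^ 2 * (n ^ 2 + Λ * (‖A'‖ * (n ^ 2 * n')) + Λ * (‖A'‖ * (n * n' ^ 2)))
        * ‖A - A'‖ * (x * y) := by
  have nA' : ‖A'.1‖ ≤ ‖A'‖ := norm_fst_le A'
  have nδ : ‖A.1 - A'.1‖ ≤ ‖A - A'‖ := norm_fst_le (A - A')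
  have pu := (norm_nonneg _).trans bu
  have pu' := (norm_nonneg _).trans bu'
  have pdu := (norm_nonneg _).trans bdu
  have split : bilin A.1 du dz - bilin A'.1 du' dz' = bilin (A.1 - A'.1) du dz
      + bilin A'.1 (du - du') dz + bilin A'.1 du' (dz - dz') := by
    rw [bilin_sub_coeff, bilin_sub_left A'.1 du, bilin_sub_right A'.1 du']
    ring
  rw [split]
  calc |bilin (A.1 - A'.1) du dz + bilin A'.1 (du - du') dz + bilin A'.1 du' (dz - dz')|
      ≤ |bilin (A.1 - A'.1) du dz| + |bilin A'.1 (du - du') dz|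
        + |bilin A'.1 du' (dz - dz')| := abs_add_three _ _ _
    _ ≤ ‖A - A'‖ * (κ * n * x) * (κ * n * y)
        + ‖A'‖ * (κ * ‖A - A'‖ * Λ * (n * n') * x) * (κ * n * y)
        + ‖A'‖ * (κ * n' * x) * (κ * ‖A - A'‖ * Λ * (n * n') * y) := by
        refine add_le_add (add_le_add ((abs_bilin_le _ _ _).trans ?_)
          ((abs_bilin_le _ _ _).trans ?_)) ((abs_bilin_le _ _ _).trans ?_)
        · gcongr
        · gcongr
        · gcongr
    _ = _ := by ring

/-- The goal functional of the double difference for two regular coefficients. -/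
theorem abs_functional_double_difference_le {K a b Creg Capprox Cunif : ℝ}
    (hK : ∀ v : H10 D, ‖toL2 D v‖ ≤ K * ‖grad D v‖) (hD : IsOpen D) (hDne : D.Nonempty)
    (hDb : Bornology.IsBounded D) (ha : 0 < a) (ha1 : a ≤ 1) {A A' : Jet1Inf D}
    (hA : IsRegularCoefficient D Creg a b A) (hA' : IsRegularCoefficient D Creg a b A')
    {X : ℕ → Submodule ℝ (H10 D)} {h : ℕ → ℝ}
    (hX : IsFEHierarchy D Capprox Cunif X h) (hCapprox : 0 ≤ Capprox) (hCreg : 0 ≤ Creg)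
    {l : ℕ} {H : ℝ} (h1 : h l ≤ H) (h2 : h (l - 1) ≤ H) (f g : L2 D) :
    |functional g ((solution (X l) A.1 f - solution (X (l - 1)) A.1 f)
        - (solution (X l) A'.1 f - solution (X (l - 1)) A'.1 f))|
      ≤ 4 * Capprox ^ 2 * Creg ^ 2 * (2 + 4 * ((1 + d) * Creg + 1)) * H ^ 2
        * goalConst a b ‖A‖ ‖A'‖ * min 1 ‖A - A'‖ * (‖f‖ * ‖g‖) := by
  -- A nonempty open set has positive measure, so almost everywhere bounds hold at some point; this
  -- gives `a ≤ b` and the lower bound `a` for the coefficient norms.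
  have : NeZero (volume.restrict D) := ⟨by
    rw [Ne, Measure.restrict_eq_zero]
    exact (hD.measure_pos volume hDne).ne'⟩
  have hab : a ≤ b := by
    obtain ⟨x, hx⟩ := hA.bounds.exists
    exact hx.1.trans hx.2
  have hnorm : ∀ B : Jet1Inf D, IsRegularCoefficient D Creg a b B → a ≤ ‖B‖ := by
    intro B hB
    obtain ⟨x, hx, hx'⟩ := (hB.bounds.and (ae_norm_le_norm B.1)).exists
    exact (hx.1.trans (le_abs_self _)).trans (hx'.trans (norm_fst_le B))
  have hN := hnorm A hA
  have hN' := hnorm A' hA'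
  have hb := ha.trans_le hab
  have hH : 0 ≤ H := (hX.mesh_pos l).le.trans h1
  set du := solution (X l) A.1 f - solution (X (l - 1)) A.1 f with hdu
  set du' := solution (X l) A'.1 f - solution (X (l - 1)) A'.1 f with hdu'
  set dz := solution (X l) A.1 g - solution (X (l - 1)) A.1 g with hdz
  set dz' := solution (X l) A'.1 g - solution (X (l - 1)) A'.1 g with hdz'
  set κ := 2 * √(b / a) * Capprox * H * Creg / a ^ 2 with hκ
  set L := (1 + (d : ℝ)) * Creg + 1 with hL
  set δ := ‖A - A'‖ with hδ
  have hκ0 : 0 ≤ κ := by positivity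
  have hL0 : 0 ≤ L := by positivity
  have hδ0 : 0 ≤ δ := norm_nonneg _
  have bu : ‖grad D du‖ ≤ κ * (1 + ‖A‖) * ‖f‖ :=
    hA.norm_grad_increment_le hK ha hb hX hCapprox hCreg h1 h2 f
  have bz : ‖grad D dz‖ ≤ κ * (1 + ‖A‖) * ‖g‖ :=
    hA.norm_grad_increment_le hK ha hb hX hCapprox hCreg h1 h2 g
  have bu' : ‖grad D du'‖ ≤ κ * (1 + ‖A'‖) * ‖f‖ :=
    hA'.norm_grad_increment_le hK ha hb hX hCapprox hCreg h1 h2 f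
  have bz' : ‖grad D dz'‖ ≤ κ * (1 + ‖A'‖) * ‖g‖ :=
    hA'.norm_grad_increment_le hK ha hb hX hCapprox hCreg h1 h2 g
  have bdu : ‖grad D (du - du')‖
      ≤ κ * δ * (L / a ^ 2) * ((1 + ‖A‖) * (1 + ‖A'‖)) * ‖f‖ :=
    hA.norm_grad_double_difference_le hK ha hb hD hDb ha1 hA' hX hCapprox hCreg h1 h2 f
  have bdz : ‖grad D (dz - dz')‖
      ≤ κ * δ * (L / a ^ 2) * ((1 + ‖A‖) * (1 + ‖A'‖)) * ‖g‖ :=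
    hA.norm_grad_double_difference_le hK ha hb hD hDb ha1 hA' hX hCapprox hCreg h1 h2 g
  have dual : functional g (du - du') = bilin A.1 du dz - bilin A'.1 du' dz' := by
    rw [functional_sub, hdu, hdu', hA.functional_increment hK ha hX,
      hA'.functional_increment hK ha hX]
  -- Here `b / a` comes from Céa's lemma and `a⁻⁴` from using regularity twice.
  have hκsq : κ ^ 2 = 4 * Capprox ^ 2 * Creg ^ 2 * H ^ 2 * (b / a ^ 5) := by
    rw [hκ, div_pow, mul_pow, mul_pow, mul_pow, mul_pow, Real.sq_sqrt (by positivity)]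
    field_simp
    ring
  have hba : 0 < b / a ^ 5 := by positivity
  obtain ⟨c1, c2, c3⟩ := one_le_mul_of_le ha ha1 hab hN hN'
  obtain ⟨c4, c5⟩ := mul_cube_le ha ha1 hN hN'
  have m1 : 1 + ‖A‖ ≤ 1 + max ‖A‖ ‖A'‖ := by gcongr; exact le_max_left _ _
  have m2 : 1 + ‖A'‖ ≤ 1 + max ‖A‖ ‖A'‖ := by gcongr; exact le_max_right _ _
  have g1 := mul_sq_le_goalConst hba (by positivity) m1 zero_le_one c1
  have g2 := mul_sq_le_goalConst hba (by positivity) m1 (norm_nonneg A) c2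
  have g3 := mul_sq_le_goalConst hba (by positivity) m2 (norm_nonneg A') c3
  have g4 := mul_cube_le_goalConst ha ha1 hab (norm_nonneg A) (norm_nonneg A') c4
  have g5 := mul_cube_le_goalConst ha ha1 hab (norm_nonneg A) (norm_nonneg A') c5
  set Q := goalConst a b ‖A‖ ‖A'‖ with hQ
  set M := 4 * Capprox ^ 2 * Creg ^ 2 * H ^ 2 with hM
  have hM0 : 0 ≤ M := by positivity
  have hQ0 : 0 ≤ Q := le_trans (by positivity) g1
  rw [dual]
  have key1 : |bilin A.1 du dz - bilin A'.1 du' dz'| ≤ M * (2 * Q) * (‖f‖ * ‖g‖) := by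
    refine (abs_bilin_sub_bilin_le A A' bu bz bu' bz').trans ?_
    rw [hκsq, mul_assoc M]
    refine mul_le_mul_of_nonneg_right (mul_le_mul_of_nonneg_left ?_ hM0) (by positivity)
    linarith
  have key2 : |bilin A.1 du dz - bilin A'.1 du' dz'|
      ≤ M * ((1 + 4 * L) * Q) * δ * (‖f‖ * ‖g‖) := by
    refine (abs_bilin_sub_bilin_le_mul A A' bu bz bu' bdu bdz).trans ?_
    rw [hκsq, mul_assoc M]
    refine mul_le_mul_of_nonneg_right (mul_le_mul_of_nonneg_right
      (mul_le_mul_of_nonneg_left ?_ hM0) hδ0) (by positivity)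
    have i4 := mul_le_mul_of_nonneg_left g4 hL0
    have i5 := mul_le_mul_of_nonneg_left g5 hL0
    refine le_of_eq_of_le ?_ ((add_le_add (add_le_add g1 i4) i5).trans (le_of_eq ?_)) <;> ring
  -- The number `2 + 4 * L` dominates both `2` from `key1` and `1 + 4 * L` from `key2`.
  have e : 4 * Capprox ^ 2 * Creg ^ 2 * (2 + 4 * L) * H ^ 2 * Q * min 1 δ * (‖f‖ * ‖g‖)
      = M * ((2 + 4 * L) * Q) * min 1 δ * (‖f‖ * ‖g‖) := by
    rw [hM]
    ring
  rw [e]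
  rcases min_cases 1 δ with ⟨hm, -⟩ | ⟨hm, -⟩ <;> rw [hm]
  · rw [mul_one]
    refine key1.trans ?_
    gcongr
    linarith
  · refine key2.trans ?_
    gcongr
    linarith

end GoalFunctional

end MIFEM

/-! ### Conclusion: passing to the mesh width of the fine level. -/

open MIFEM
theorem theorem3p9 {d : ℕ} (hd : d = 2 ∨ d = 3) (D : Set (Space d)) (hDo : IsOpen D)
    (hDc : IsConnected D) (hDb : Bornology.IsBounded D)
    (Capprox Creg Cunif : ℝ) (hCapprox : 0 < Capprox) (hCreg : 0 < Creg) (hCunif : 0 < Cunif) :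
    ∃ C : ℝ, 0 < C ∧
      ∀ (Amin Amax : ℝ), 0 < Amin → Amin ≤ 1 →
      ∀ (Ω : Type*) [MeasurableSpace Ω] (P : Measure Ω) [IsProbabilityMeasure P]
        (Ω₀ : Set Ω) (A : ℕ → Ω → Jet1Inf D),
        IsRandomCoefficient D Creg Amin Amax P Ω₀ A →
      ∀ (X : ℕ → Submodule ℝ (H10 D)) (h : ℕ → ℝ), IsFEHierarchy D Capprox Cunif X h →
      ∀ (f g : L2 D), ∀ ω ∈ Ω₀, ∀ l ν : ℕ, 1 ≤ l → 1 ≤ ν →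
        |functional g (doubleDiff X A f l ν ω)| ≤
          C * goalConst Amin Amax ‖A ν ω‖ ‖A (ν - 1) ω‖ * h l ^ 2 *
            min 1 ‖A ν ω - A (ν - 1) ω‖ * ‖f‖ * ‖g‖ := by
  obtain ⟨K, -, hK⟩ := exists_norm_toL2_le (by omega) hDo.measurableSet hDb
  refine ⟨4 * Capprox ^ 2 * Creg ^ 2 * (2 + 4 * ((1 + d) * Creg + 1)) * (Cunif ^ 2)⁻¹,
    by positivity, ?_⟩
  intro Amin Amax ha ha1 Ω _ P _ Ω₀ A hA X h hX f g ω hω l ν hl _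
  -- The common bound is `H = h l / Cunif`, whose square accounts for `(Cunif ^ 2)⁻¹` in `C`. The
  -- condition `1 ≤ l` makes `l - 1` the true predecessor.
  have h2 : h (l - 1) ≤ h l / Cunif := by
    rw [le_div_iff₀' hCunif]
    simpa [Nat.sub_add_cancel hl] using hX.mesh_ratio (l - 1)
  have h1 : h l ≤ h l / Cunif := (hX.mesh_antitone (Nat.sub_le l 1)).trans h2
  refine (abs_functional_double_difference_le hK hDo hDc.nonempty hDb ha ha1
    (hA.isRegularCoefficient hω ν) (hA.isRegularCoefficient hω (ν - 1)) hX hCapprox.le hCreg.le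
    h1 h2 f g).trans (le_of_eq ?_)
  rw [div_pow]
  ring
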